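/- Let $N\ge 0$ be an integer, let $I_i=[a_i,b_i]$ with $a_i<b_i$ ($i=1,\dots,N$) be finite intervals, and let $K_{ij}\colon I_i\times I_j\to\mathbb{C}$ ($i,j=1,\dots,N$) be continuous. The Fredholm determinant of the system is $$d(z)=\sum_{n=0}^\infty\frac{z^n}{n!}\sum_{i_1,\dots,i_n=1}^N\int_{I_{i_1}\times\cdots\times I_{i_n}}\det\bigl(K_{i_pi_q}(t_p,t_q)\bigr)_{p,q=1}^n\,dt_1\cdots dt_n\qquad(z\in\mathbb{C}).$$ All these integrals exist, the series converges for every $z\in\mathbb{C}$, and $d$ is an entire function. For $i=1,\dots,N$ let $Q_i(f)=\sum_{p=1}^{m_i}w_{ip}f(x_{ip})$ be a quadrature rule on $I_i$ with nodes $x_{ip}\in I_i$. The rule $Q_i$ is of order $\nu\ge1$ if $Q_i(f)=\int_{I_i}f(x)\,dx$ for all polynomials $f$ of degree at most $\nu-1$. For a family $Q=(Q_1,\dots,Q_N)$ with positive weights put $d_Q(z)=\det(I+zA_Q)$, where $A_Q$ is the $N\times N$ block matrix whose blocks $A_{ij}\in\mathbb{C}^{m_i\times m_j}$ have the entries $$(A_{ij})_{pq}=w_{ip}^{1/2}K_{ij}(x_{ip},x_{jq})\,w_{jq}^{1/2}.$$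 (a) Let $k\ge1$ and assume that $K_{ij}\in C^{k-1,1}(I_i\times I_j)$ for all $i,j$ (that is, $K_{ij}$ is $k-1$ times continuously differentiable with Lipschitz continuous derivatives of order $k-1$). Then for quadrature rules $Q_1,\dots,Q_N$ of a common order $\nu\ge k$ with positive weights $$d_Q(z)-d(z)=O(\nu^{-k})\qquad(\nu\to\infty),$$ uniformly for bounded $z$: for every $R$ there is a constant $C$ such that $|d_Q(z)-d(z)|\le C\nu^{-k}$ for all $\nu\ge k$, all such families $Q$ of common order $\nu$, and all $|z|\le R$. (b) For $\rho>1$ let $\mathcal{E}_\rho(I_i)\subset\mathbb{C}$ be the interior of the ellipse with foci $a_i,b_i$ and semiaxes of lengths $s>\sigma>0$ such that $\rho=\sqrt{(s+\sigma)/(s-\sigma)}$. Assume that each $K_{ij}$ extends to a bounded analytic function on $\mathcal{E}_\rho(I_i)\times\mathcal{E}_\rho(I_j)$. Then for quadrature rules $Q_1,\dots,Q_N$ of a common order $\nu\ge1$ with positive weights $$d_Q(z)-d(z)=O(\rho^{-\nu})\qquad(\nu\to\infty),$$ uniformly for bounded $z$: for every $R$ there is a constant $C$ such that $|d_Q(z)-d(z)|\le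 C\rho^{-\nu}$ for all $\nu\ge1$, all such families $Q$ of common order $\nu$, and all $|z|\le R$. -/

import Mathlib

open scoped NNReal

noncomputable section

/-- `f` is of class `C^{m,1}` on `s`: it is `m` times continuously differentiable on `s` and its
derivative of order `m` is Lipschitz continuous on `s`. -/
def IsCLip {E F : Type*} [NormedAddCommGroup E] [NormedSpace ℝ E]
    [NormedAddCommGroup F] [NormedSpace ℝ F] (m : ℕ) (f : E → F) (s : Set E) : Prop :=
  ContDiffOn ℝ m f s ∧ ∃ L : ℝ≥0, LipschitzOnWith L (iteratedFDerivWithin ℝ m f s) s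

/-- The (open) Bernstein ellipse of the interval `[a, b]` with parameter `ρ > 1`: the interior of
the ellipse with foci `a`, `b` and major semiaxis `s = (b - a) / 4 * (ρ + 1 / ρ)`. The lemma
`bernsteinEllipse_eq` relates `ρ` to the lengths of the two semiaxes. -/
def bernsteinEllipse (a b ρ : ℝ) : Set ℂ :=
  {z | dist z (a : ℂ) + dist z (b : ℂ) < 2 * ((b - a) / 4 * (ρ + ρ⁻¹))}

/-- If an ellipse with foci `a < b` has semiaxes of lengths `s > σ > 0` and
`ρ = √((s + σ) / (s - σ))`, then `bernsteinEllipse a b ρ` is the interior of that ellipse. -/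
theorem bernsteinEllipse_eq (a b s σ : ℝ) (hab : a < b) (hσ : 0 < σ) (hs : σ < s)
    (hfoci : s ^ 2 - σ ^ 2 = ((b - a) / 2) ^ 2) :
    bernsteinEllipse a b (Real.sqrt ((s + σ) / (s - σ))) =
      {z : ℂ | dist z (a : ℂ) + dist z (b : ℂ) < 2 * s} := by
  have h1 : 0 < s - σ := by linarith
  have h2 : 0 < s + σ := by linarith
  have h3 : 0 < b - a := by linarith
  have hr : Real.sqrt ((s + σ) / (s - σ)) = 2 * (s + σ) / (b - a) := by
    rw [Real.sqrt_eq_iff_mul_self_eq (by positivity) (by positivity)]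
    field_simp
    nlinarith
  have hs' : (b - a) / 4 * (2 * (s + σ) / (b - a) + (2 * (s + σ) / (b - a))⁻¹) = s := by
    field_simp
    nlinarith
  simp only [bernsteinEllipse, hr, hs']

/-- A quadrature rule `Q(f) = ∑ j, w j * f (x j)` on `[a, b]`, with nodes in `[a, b]`. -/
structure QuadratureRule (a b : ℝ) where
  size : ℕ
  weight : Fin size → ℝ
  node : Fin size → ℝ
  node_mem : ∀ j, node j ∈ Set.Icc a b

namespace QuadratureRule

/-- The value `Q(f)`. -/
def apply {a b : ℝ} (Q : QuadratureRule a b) (f : ℝ → ℝ) : ℝ :=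
  ∑ j, Q.weight j * f (Q.node j)

/-- `Q` is of order `ν ≥ 1`: it is exact for all polynomials of degree at most `ν - 1`. -/
def HasOrder {a b : ℝ} (Q : QuadratureRule a b) (ν : ℕ) : Prop :=
  1 ≤ ν ∧ ∀ P : Polynomial ℝ, P.natDegree ≤ ν - 1 →
    Q.apply (fun x => P.eval x) = ∫ x in a..b, P.eval x

/-- All weights are positive. -/
def HasPosWeights {a b : ℝ} (Q : QuadratureRule a b) : Prop :=
  ∀ j, 0 < Q.weight j

end QuadratureRule

/-- The function `K_{i_1, …, i_n}(t_1, …, t_n) = det (K_{i_p i_q}(t_p, t_q))_{p, q}`. -/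
def kernelMinor {N : ℕ} (K : Fin N → Fin N → ℝ → ℝ → ℂ) {n : ℕ}
    (i : Fin n → Fin N) (t : Fin n → ℝ) : ℂ :=
  (Matrix.of fun p q : Fin n => K (i p) (i q) (t p) (t q)).det

/-- The box `I_{i_1} × ⋯ × I_{i_n}`, where `I_j = [a j, b j]`. -/
def intervalBox {N : ℕ} (a b : Fin N → ℝ) {n : ℕ} (i : Fin n → Fin N) : Set (Fin n → ℝ) :=
  Set.univ.pi fun p => Set.Icc (a (i p)) (b (i p))

/-- The `n`-th term of the Fredholm series of a system of kernels. -/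
def fredholmTerm {N : ℕ} (a b : Fin N → ℝ) (K : Fin N → Fin N → ℝ → ℝ → ℂ)
    (z : ℂ) (n : ℕ) : ℂ :=
  z ^ n / (n.factorial : ℂ) *
    ∑ i : Fin n → Fin N, ∫ t in intervalBox a b i, kernelMinor K i t

/-- The Fredholm determinant `d(z)` of the system of kernels `K i j` on `I_i × I_j`. -/
def fredholmDet {N : ℕ} (a b : Fin N → ℝ) (K : Fin N → Fin N → ℝ → ℝ → ℂ) (z : ℂ) : ℂ :=
  ∑' n : ℕ, fredholmTerm a b K z n

/-- The block matrix `A_Q` with entries `(A_{ij})_{pq} = w_{ip}^{1/2} K_{ij}(x_{ip}, x_{jq})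
w_{jq}^{1/2}`; rows and columns are indexed by the pairs `(i, p)`. -/
def nystromMatrix {N : ℕ} {a b : Fin N → ℝ} (K : Fin N → Fin N → ℝ → ℝ → ℂ)
    (Q : ∀ i, QuadratureRule (a i) (b i)) :
    Matrix (Σ i, Fin (Q i).size) (Σ i, Fin (Q i).size) ℂ :=
  Matrix.of fun ip jq =>
    (Real.sqrt ((Q ip.1).weight ip.2) : ℂ) *
      K ip.1 jq.1 ((Q ip.1).node ip.2) ((Q jq.1).node jq.2) *
      (Real.sqrt ((Q jq.1).weight jq.2) : ℂ)

/-- The block Nyström approximation `d_Q(z) = det (I + z A_Q)`. -/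
def nystromDet {N : ℕ} {a b : Fin N → ℝ} (K : Fin N → Fin N → ℝ → ℝ → ℂ)
    (Q : ∀ i, QuadratureRule (a i) (b i)) (z : ℂ) : ℂ :=
  (1 + z • nystromMatrix K Q).det

/-- The kernel `k` on `[a, b] × [c, d]` is bounded analytic on
`bernsteinEllipse a b ρ × bernsteinEllipse c d ρ`, that is, it is the restriction of a bounded
analytic function on that product. -/
def IsBoundedAnalyticKernel (a b c d ρ : ℝ) (k : ℝ → ℝ → ℂ) : Prop :=
  ∃ F : ℂ × ℂ → ℂ,
    AnalyticOnNhd ℂ F (bernsteinEllipse a b ρ ×ˢ bernsteinEllipse c d ρ) ∧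
    (∃ B : ℝ, ∀ p ∈ bernsteinEllipse a b ρ ×ˢ bernsteinEllipse c d ρ, ‖F p‖ ≤ B) ∧
    ∀ x ∈ Set.Icc a b, ∀ y ∈ Set.Icc c d, F ((x : ℂ), (y : ℂ)) = k x y

end

open scoped NNReal
open Polynomial MeasureTheory

noncomputable section

/-! Von Koch's formula expands det(I + z A_Q) in powers of z. Its n-th term is the n-th Fredholm
term with every integral over a box replaced by the product quadrature rule, since the square roots
of the weights recombine into products of weights (`hasSum_nystromDet`). So d_Q - d is, term by
term, a sum of product quadrature errors of minors of K.

Positive weights sum to the length of the interval. Peeling off one coordinate at a time therefore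
bounds the n-dimensional error by n L^n times the largest one-dimensional error
(`norm_product_quadrature_sub_integral_le`). By exactness and positivity, the one-dimensional error
is at most 2(b - a) times the distance to polynomials of degree at most ν - 1. Hadamard's inequality
limits the growth of the minors to n^(n/2) B^n, which the n! in the series absorbs. Hence the
approximation rate comes out as a factor (`norm_nystromDet_sub_fredholmDet_le`).

What remains is to approximate a minor as a function of a single variable t_p, which enters only row
p and column p. (a) Jackson's theorem approximates the entries by polynomials of degree h =
⌊(ν-1)/2⌋. The determinant of the approximants has degree at most 2h ≤ ν - 1, and halving the degree
costs only a constant in an algebraic rate. (b) Halving the degree would halve the exponent of ρ. So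
Bernstein's theorem is applied to the minor itself, which is holomorphic on the ellipse and bounded
there by Hadamard's inequality. -/

/-! ### Hadamard's inequality and the majorant series. -/

open scoped ComplexOrder in
/-- A form of **Hadamard's inequality**. -/
theorem norm_det_le_of_norm_le {n : ℕ} (A : Matrix (Fin n) (Fin n) ℂ) {B : ℝ}
    (hA : ∀ i j, ‖A i j‖ ≤ B) : ‖A.det‖ ≤ √((n : ℝ) ^ n) * B ^ n := by
  rcases Nat.eq_zero_or_pos n with rfl | hn
  · simp
  have hB : 0 ≤ B := (norm_nonneg _).trans (hA ⟨0, hn⟩ ⟨0, hn⟩)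
  have hn' : (0 : ℝ) < n := by exact_mod_cast hn
  have hps := Matrix.posSemidef_self_mul_conjTranspose A
  have hH := hps.isHermitian
  have hdet : ‖A.det‖ ^ 2 = ∏ i, hH.eigenvalues i := by
    have h1 : (A * A.conjTranspose).det = ((‖A.det‖ ^ 2 : ℝ) : ℂ) := by
      rw [Matrix.det_mul, Matrix.det_conjTranspose, Complex.star_def, Complex.mul_conj,
        Complex.normSq_eq_norm_sq]
    have h2 := hH.det_eq_prod_eigenvalues
    rw [h1] at h2
    apply Complex.ofReal_injective
    rw [Complex.ofReal_prod]
    exact h2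
  have htr : ∑ i, hH.eigenvalues i ≤ n * (n * B ^ 2) := by
    have h2 := hH.trace_eq_sum_eigenvalues
    have h3 : (A * A.conjTranspose).trace = ((∑ i, ∑ j, ‖A i j‖ ^ 2 : ℝ) : ℂ) := by
      simp only [Matrix.trace, Matrix.diag, Matrix.mul_apply, Matrix.conjTranspose_apply,
        Complex.star_def, Complex.mul_conj, Complex.normSq_eq_norm_sq]
      push_cast
      rfl
    rw [h3] at h2
    have h4 : ∑ i, hH.eigenvalues i = ∑ i, ∑ j, ‖A i j‖ ^ 2 := by
      apply Complex.ofReal_injective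
      rw [Complex.ofReal_sum]
      exact h2.symm
    rw [h4]
    calc ∑ i, ∑ j, ‖A i j‖ ^ 2 ≤ ∑ _i : Fin n, ∑ _j : Fin n, B ^ 2 := by
          gcongr with i _ j _
          exact hA i j
      _ = _ := by simp
  -- The eigenvalues of A A* have product |det A|² and sum at most n² B², so AM-GM gives |det A|² ≤
  -- (n B²)^n.
  have ham := Real.geom_mean_le_arith_mean Finset.univ (fun _ => (1 : ℝ)) hH.eigenvalues
    (by simp) (by simpa using hn) (fun i _ => hps.eigenvalues_nonneg i)
  simp only [Real.rpow_one, one_mul, Finset.sum_const, Finset.card_univ, Fintype.card_fin,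
    nsmul_eq_mul, mul_one] at ham
  have hP : 0 ≤ ∏ i, hH.eigenvalues i := Finset.prod_nonneg fun i _ => hps.eigenvalues_nonneg i
  have hb : (∏ i, hH.eigenvalues i) ^ ((n : ℝ)⁻¹) ≤ n * B ^ 2 := by
    refine ham.trans ?_
    rw [div_le_iff₀ hn']
    linarith
  have hb2 : ∏ i, hH.eigenvalues i ≤ (n * B ^ 2) ^ n := by
    have := pow_le_pow_left₀ (Real.rpow_nonneg hP _) hb n
    rwa [Real.rpow_inv_natCast_pow hP hn.ne'] at this
  refine (sq_le_sq₀ (by positivity) (by positivity)).1 ?_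
  rw [hdet, mul_pow, Real.sq_sqrt (by positivity)]
  refine hb2.trans (le_of_eq ?_)
  rw [mul_pow, ← pow_mul, ← pow_mul, mul_comm 2 n]

/-- Rescaling row p by 1/ε makes all entries bounded by B; linearity of the determinant in that row
returns the factor ε. -/
theorem norm_det_le_of_row_le {n : ℕ} (A : Matrix (Fin n) (Fin n) ℂ) (p : Fin n) {B ε : ℝ}
    (hε : 0 < ε) (hp : ∀ j, ‖A p j‖ ≤ ε * B) (hA : ∀ i j, i ≠ p → ‖A i j‖ ≤ B) :
    ‖A.det‖ ≤ ε * (√((n : ℝ) ^ n) * B ^ n) := by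
  have h1 : A = A.updateRow p ((ε : ℂ) • ((ε : ℂ)⁻¹ • A p)) := by
    rw [smul_smul, mul_inv_cancel₀ (by exact_mod_cast hε.ne'), one_smul,
      Matrix.updateRow_eq_self]
  rw [h1, Matrix.det_updateRow_smul, norm_mul, Complex.norm_real, Real.norm_of_nonneg hε.le]
  refine mul_le_mul_of_nonneg_left (norm_det_le_of_norm_le _ fun i j => ?_) hε.le
  rw [Matrix.updateRow_apply]
  split_ifs with h
  · simp only [Pi.smul_apply, smul_eq_mul, norm_mul, norm_inv, Complex.norm_real,
      Real.norm_of_nonneg hε.le]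
    rw [inv_mul_le_iff₀ hε]
    exact hp j
  · exact hA i j h

theorem norm_det_le_of_col_le {n : ℕ} (A : Matrix (Fin n) (Fin n) ℂ) (p : Fin n) {B ε : ℝ}
    (hε : 0 < ε) (hp : ∀ j, ‖A j p‖ ≤ ε * B) (hA : ∀ i j, j ≠ p → ‖A i j‖ ≤ B) :
    ‖A.det‖ ≤ ε * (√((n : ℝ) ^ n) * B ^ n) := by
  rw [← Matrix.det_transpose]
  exact norm_det_le_of_row_le _ p hε hp fun i j h => hA j i h

theorem summable_hadamard (c : ℝ) (hc : 0 ≤ c) :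
    Summable fun n : ℕ => ((n : ℝ) + 1) * c ^ n * √((n : ℝ) ^ n) / n.factorial := by
  -- With n + 1 ≤ 2^n and √(n^n) ≤ e^n √(n!), the term is at most (1/2)^n s^n / √(n!). Of the 4 in
  -- s, one factor 2 pays for n + 1 and the other leaves a geometric series.
  set s : ℝ := 4 * c * Real.exp 1
  have hs : 0 ≤ s := by positivity
  refine Summable.of_nonneg_of_le (fun n => by positivity) (fun n => ?_)
    ((summable_geometric_two).mul_left (Real.exp (s ^ 2)))
  have hf : (0 : ℝ) < n.factorial := by positivity
  have hn2 : (n : ℝ) + 1 ≤ 2 ^ n := by exact_mod_cast Nat.lt_two_pow_self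
  have h1 : √((n : ℝ) ^ n) ≤ Real.exp 1 ^ n * √(n.factorial) := by
    refine Real.sqrt_le_iff.2 ⟨by positivity, ?_⟩
    rw [mul_pow, Real.sq_sqrt hf.le]
    have h2 := Real.pow_div_factorial_le_exp (n : ℝ) (by positivity) n
    rw [div_le_iff₀ hf] at h2
    refine h2.trans ?_
    gcongr
    rw [← Real.exp_nat_mul, mul_one, ← Real.exp_nat_mul]
    apply Real.exp_le_exp.2
    have : (0 : ℝ) ≤ n := by positivity
    push_cast
    linarith
  have h3 : s ^ n ≤ Real.exp (s ^ 2) * √(n.factorial) := by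
    have h4 := Real.pow_div_factorial_le_exp (s ^ 2) (by positivity) n
    rw [div_le_iff₀ hf] at h4
    refine (sq_le_sq₀ (by positivity) (by positivity)).1 ?_
    rw [mul_pow (Real.exp _), Real.sq_sqrt hf.le, ← pow_mul, mul_comm n 2, pow_mul]
    refine h4.trans ?_
    gcongr
    rw [← Real.exp_nat_mul]
    apply Real.exp_le_exp.2
    have : 0 ≤ s ^ 2 := by positivity
    push_cast
    linarith
  rw [div_le_iff₀ hf]
  have hsq : √(n.factorial : ℝ) * √(n.factorial : ℝ) = n.factorial := Real.mul_self_sqrt hf.le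
  calc ((n : ℝ) + 1) * c ^ n * √((n : ℝ) ^ n) ≤ 2 ^ n * c ^ n * (Real.exp 1 ^ n * √(n.factorial)) := by gcongr
    _ = (1 / 2) ^ n * s ^ n * √(n.factorial) := by
        have : (2 : ℝ) ^ n = (1 / 2) ^ n * 4 ^ n := by rw [← mul_pow]; norm_num
        simp only [s, mul_pow, this]
        ring
    _ ≤ (1 / 2) ^ n * (Real.exp (s ^ 2) * √(n.factorial)) * √(n.factorial) := by gcongr
    _ = _ := by rw [mul_assoc, mul_assoc, hsq]; ring

/-! ### Von Koch's formula for finite matrices. -/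

/-- The minors of `A` with rows and columns `f : Fin n → S` sum to `n!` times the sum of the
principal minors of size `n`. -/
theorem sum_det_submatrix_eq {S : Type*} [Fintype S] [DecidableEq S] (A : Matrix S S ℂ) (n : ℕ) :
    ∑ f : Fin n → S, (A.submatrix f f).det = n.factorial *
      ∑ s ∈ Finset.univ.powersetCard n,
        (A.submatrix (Subtype.val : s → S) (Subtype.val : s → S)).det := by
  classical
  -- A repeated index gives two equal rows, so only injective f count. Each n-element set is the
  -- image of n! of them, all with the same principal minor.
  have hni : ∀ f : Fin n → S, ¬ Function.Injective f → (A.submatrix f f).det = 0 := by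
    intro f hf
    simp only [Function.Injective, not_forall] at hf
    obtain ⟨i, j, hij, hne⟩ := hf
    exact Matrix.det_zero_of_row_eq hne (by ext k; simp [hij])
  rw [← Finset.sum_filter_add_sum_filter_not Finset.univ (fun f : Fin n → S =>
    Function.Injective f), Finset.sum_eq_zero (s := Finset.univ.filter fun f : Fin n → S =>
    ¬ Function.Injective f) (fun f hf => hni f (by simpa using hf)), add_zero]
  rw [← Finset.sum_fiberwise_of_maps_to (t := Finset.univ.powersetCard n)
    (g := fun f : Fin n → S => Finset.univ.image f), Finset.mul_sum]
  · refine Finset.sum_congr rfl fun s hs => ?_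
    have hcard : s.card = n := (Finset.mem_powersetCard.1 hs).2
    have hval : ∀ f ∈ (Finset.univ.filter fun f : Fin n → S => Function.Injective f).filter
        (fun f => Finset.univ.image f = s), (A.submatrix f f).det =
        (A.submatrix (Subtype.val : s → S) (Subtype.val : s → S)).det := by
      intro f hf
      simp only [Finset.mem_filter, Finset.mem_univ, true_and] at hf
      obtain ⟨hinj, him⟩ := hf
      have hmem : ∀ i, f i ∈ s := fun i => by rw [← him]; simp
      let g : Fin n → s := fun i => ⟨f i, hmem i⟩
      have hg : Function.Bijective g := by
        rw [Fintype.bijective_iff_injective_and_card]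
        refine ⟨fun i j hij => hinj (congrArg Subtype.val hij), by simp [hcard]⟩
      rw [← Matrix.det_submatrix_equiv_self (Equiv.ofBijective g hg)]
      rfl
    rw [Finset.sum_congr rfl hval, Finset.sum_const, nsmul_eq_mul]
    congr 2
    let e : (Fin n ≃ s) ≃ {f // f ∈ (Finset.univ.filter fun f : Fin n → S =>
        Function.Injective f).filter (fun f => Finset.univ.image f = s)} :=
      { toFun := fun e => ⟨fun i => e i, by
          simp only [Finset.mem_filter, Finset.mem_univ, true_and]
          refine ⟨Subtype.val_injective.comp e.injective, ?_⟩
          ext x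
          simp only [Finset.mem_image, Finset.mem_univ, true_and]
          refine ⟨fun ⟨i, hi⟩ => hi ▸ (e i).2, fun hx => ⟨e.symm ⟨x, hx⟩, by simp⟩⟩⟩
        invFun := fun f => Equiv.ofBijective (fun i => (⟨f.1 i, by
            have := f.2
            simp only [Finset.mem_filter, Finset.mem_univ, true_and] at this
            exact (Finset.ext_iff.1 this.2 _).1 (Finset.mem_image_of_mem _ (Finset.mem_univ i))⟩ : s)) (by
          have := f.2
          simp only [Finset.mem_filter, Finset.mem_univ, true_and] at this
          rw [Fintype.bijective_iff_injective_and_card]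
          refine ⟨fun i j hij => this.1 (congrArg Subtype.val hij), by simp [hcard]⟩)
        left_inv := fun e => by ext i; rfl
        right_inv := fun f => by ext i; rfl }
    rw [← Fintype.card_coe, ← Fintype.card_congr e, Fintype.card_equiv
      (s.equivFinOfCardEq hcard).symm, Fintype.card_fin]
  · intro f hf
    simp only [Finset.mem_filter, Finset.mem_univ, true_and] at hf
    simp [Finset.mem_powersetCard, Finset.card_image_of_injective _ hf]

/-- **von Koch's formula** for the determinant of `1 + z A`. -/
theorem hasSum_det_one_add_smul {S : Type*} [Fintype S] [DecidableEq S] (A : Matrix S S ℂ)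
    (z : ℂ) : HasSum (fun n : ℕ => z ^ n / (n.factorial : ℂ) *
      ∑ f : Fin n → S, (A.submatrix f f).det) (1 + z • A).det := by
  set P : Polynomial ℂ := (1 + (Polynomial.X : Polynomial ℂ) • A.map Polynomial.C).det
  have hP : (1 + z • A).det = P.eval z := by
    rw [← Polynomial.coe_evalRingHom, RingHom.map_det]
    congr 1
    ext i j
    simp only [Matrix.smul_apply, Matrix.add_apply, RingHom.mapMatrix_apply, Matrix.map_apply,
      Polynomial.coe_evalRingHom, smul_eq_mul, Polynomial.eval_add, Polynomial.eval_mul,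
      Polynomial.eval_X, Polynomial.eval_C, Matrix.one_apply]
    split_ifs <;> simp
  rw [hP, Polynomial.eval_eq_sum_range]
  have hterm : ∀ n : ℕ, z ^ n / (n.factorial : ℂ) * ∑ f : Fin n → S, (A.submatrix f f).det =
      P.coeff n * z ^ n := by
    intro n
    rw [sum_det_submatrix_eq, Matrix.coeff_det_one_add_X_smul_eq_sum_minors]
    have : (n.factorial : ℂ) ≠ 0 := by exact_mod_cast n.factorial_ne_zero
    field_simp
  simp only [hterm]
  refine hasSum_sum_of_ne_finset_zero fun n hn => ?_
  rw [Polynomial.coeff_eq_zero_of_natDegree_lt (by simpa using hn), zero_mul]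

/-! ### Product quadrature on boxes. -/

theorem update_mem_pi_Icc {n : ℕ} {a b t : Fin n → ℝ}
    (ht : t ∈ Set.univ.pi fun p => Set.Icc (a p) (b p)) (p : Fin n) {s : ℝ}
    (hs : s ∈ Set.Icc (a p) (b p)) :
    Function.update t p s ∈ Set.univ.pi fun p => Set.Icc (a p) (b p) := by
  intro q _
  rcases eq_or_ne q p with rfl | h
  · simpa using hs
  · simpa [h] using ht q trivial

theorem cons_mem_pi_Icc {n : ℕ} {a b : Fin (n + 1) → ℝ} {s : ℝ} {t : Fin n → ℝ}
    (hs : s ∈ Set.Icc (a 0) (b 0))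
    (ht : t ∈ Set.univ.pi fun p : Fin n => Set.Icc (a p.succ) (b p.succ)) :
    (Fin.cons s t : Fin (n + 1) → ℝ) ∈ Set.univ.pi fun p => Set.Icc (a p) (b p) := by
  intro q _
  refine Fin.cases ?_ (fun q => ?_) q
  · simpa using hs
  · simpa using ht q trivial

theorem isCompact_pi_Icc {n : ℕ} (a b : Fin n → ℝ) :
    IsCompact (Set.univ.pi fun p => Set.Icc (a p) (b p)) :=
  isCompact_univ_pi fun _ => isCompact_Icc

theorem volume_real_pi_Icc_le {n : ℕ} {a b : Fin n → ℝ} {L : ℝ} (hab : ∀ p, a p ≤ b p)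
    (hL : ∀ p, b p - a p ≤ L) :
    volume.real (Set.univ.pi fun p => Set.Icc (a p) (b p)) ≤ L ^ n := by
  rw [Measure.real, Set.pi_univ_Icc, Real.volume_Icc_pi_toReal hab]
  calc ∏ p, (b p - a p) ≤ ∏ _p : Fin n, L :=
        Finset.prod_le_prod (fun p _ => sub_nonneg.2 (hab p)) fun p _ => hL p
    _ = L ^ n := by simp

theorem setIntegral_pi_Icc_succ {n : ℕ} {a b : Fin (n + 1) → ℝ} {f : (Fin (n + 1) → ℝ) → ℂ}
    (hf : ContinuousOn f (Set.univ.pi fun p => Set.Icc (a p) (b p))) :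
    IntegrableOn (fun x : ℝ × (Fin n → ℝ) => f (Fin.cons x.1 x.2))
      (Set.Icc (a 0) (b 0) ×ˢ Set.univ.pi fun p : Fin n => Set.Icc (a p.succ) (b p.succ))
      (volume.prod volume) ∧
    ∫ t in Set.univ.pi fun p => Set.Icc (a p) (b p), f t =
      ∫ x in Set.Icc (a 0) (b 0) ×ˢ Set.univ.pi fun p : Fin n => Set.Icc (a p.succ) (b p.succ),
        f (Fin.cons x.1 x.2) ∂(volume.prod volume) := by
  set e := (MeasurableEquiv.piFinSuccAbove (fun _ : Fin (n + 1) => ℝ) 0).symm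
  have he : MeasurePreserving e :=
    (volume_preserving_piFinSuccAbove (fun _ : Fin (n + 1) => ℝ) 0).symm _
  have hev : ∀ x, e x = Fin.cons x.1 x.2 := by
    intro x
    simp [e, MeasurableEquiv.piFinSuccAbove, Fin.insertNthEquiv]
  have hpre : e ⁻¹' (Set.univ.pi fun p => Set.Icc (a p) (b p)) =
      Set.Icc (a 0) (b 0) ×ˢ Set.univ.pi fun p : Fin n => Set.Icc (a p.succ) (b p.succ) := by
    ext x
    simp only [Set.mem_preimage, hev, Set.mem_pi, Set.mem_univ, true_imp_iff, Fin.forall_fin_succ,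
      Fin.cons_zero, Fin.cons_succ, Set.mem_prod]
  have hint : IntegrableOn f (Set.univ.pi fun p => Set.Icc (a p) (b p)) :=
    hf.integrableOn_compact (isCompact_pi_Icc a b)
  constructor
  · have := (he.integrableOn_comp_preimage e.measurableEmbedding).2 hint
    rw [hpre] at this
    exact this.congr_fun (fun x _ => by simp [hev])
      (measurableSet_Icc.prod (MeasurableSet.univ_pi fun _ => measurableSet_Icc))
  · rw [← he.setIntegral_preimage_emb e.measurableEmbedding, hpre]
    simp only [hev]
    rfl

theorem sum_prod_mul_fin_succ {n : ℕ} (m : Fin (n + 1) → ℕ) (w x : ∀ p, Fin (m p) → ℝ)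
    (f : (Fin (n + 1) → ℝ) → ℂ) :
    ∑ j : (∀ p, Fin (m p)), ((∏ p, w p (j p) : ℝ) : ℂ) * f (fun p => x p (j p)) =
      ∑ j₀ : Fin (m 0), (w 0 j₀ : ℂ) * ∑ j : (∀ p : Fin n, Fin (m p.succ)),
        ((∏ p, w p.succ (j p) : ℝ) : ℂ) * f (Fin.cons (x 0 j₀) fun p => x p.succ (j p)) := by
  rw [← (Fin.consEquiv fun p => Fin (m p)).sum_comp, Fintype.sum_prod_type]
  refine Finset.sum_congr rfl fun j₀ _ => ?_
  rw [Finset.mul_sum]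
  refine Finset.sum_congr rfl fun j _ => ?_
  rw [Fin.prod_univ_succ]
  push_cast
  rw [← mul_assoc]
  congr 2
  funext p
  refine Fin.cases ?_ (fun p => ?_) p <;> simp [Fin.consEquiv]

/-- The error of a product quadrature rule is controlled by the errors in each coordinate. -/
theorem norm_product_quadrature_sub_integral_le {L ε : ℝ} (hL : 1 ≤ L) (hε : 0 ≤ ε) :
    ∀ {n : ℕ} (a b : Fin n → ℝ) (_ : ∀ p, a p ≤ b p) (_ : ∀ p, b p - a p ≤ L)
      (m : Fin n → ℕ) (w x : ∀ p, Fin (m p) → ℝ) (_ : ∀ p j, 0 ≤ w p j)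
      (_ : ∀ p, ∑ j, w p j ≤ L) (_ : ∀ p j, x p j ∈ Set.Icc (a p) (b p))
      (f : (Fin n → ℝ) → ℂ) (_ : ContinuousOn f (Set.univ.pi fun p => Set.Icc (a p) (b p)))
      (_ : ∀ p, ∀ t ∈ Set.univ.pi fun p => Set.Icc (a p) (b p),
        ‖∑ j, (w p j : ℂ) * f (Function.update t p (x p j)) -
          ∫ s in Set.Icc (a p) (b p), f (Function.update t p s)‖ ≤ ε),
      ‖∑ j : (∀ p, Fin (m p)), ((∏ p, w p (j p) : ℝ) : ℂ) * f (fun p => x p (j p)) -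
        ∫ t in Set.univ.pi fun p => Set.Icc (a p) (b p), f t‖ ≤ n * L ^ n * ε := by
  intro n
  induction n with
  | zero =>
    intro a b _ _ m w x _ _ _ f _ _
    have h1 : (Set.univ.pi fun p : Fin 0 => Set.Icc (a p) (b p)) = Set.univ :=
      Set.eq_univ_of_forall fun t p => p.elim0
    have hv : (volume : Measure (Fin 0 → ℝ)) = Measure.dirac default := by
      rw [volume_pi, Measure.pi_of_empty]
      congr 1
      exact Subsingleton.elim _ _
    rw [h1, Measure.restrict_univ, hv, integral_dirac]
    simp only [Finset.univ_unique, Finset.sum_singleton, Finset.univ_eq_empty, Finset.prod_empty]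
    rw [Subsingleton.elim (fun p : Fin 0 => x p ((default : ∀ p, Fin (m p)) p)) default]
    simp
  | succ n ih =>
    intro a b hab hL' m w x hw hws hx f hf he
    set S := Set.univ.pi fun p : Fin n => Set.Icc (a p.succ) (b p.succ) with hS
    have hSm : MeasurableSet S := MeasurableSet.univ_pi fun _ => measurableSet_Icc
    have hSc : IsCompact S := isCompact_pi_Icc _ _
    have hSfin : volume S < ⊤ := hSc.measure_lt_top
    have hSvol : volume.real S ≤ L ^ n := volume_real_pi_Icc_le (fun p => hab _) fun p => hL' _
    have hcons : ∀ s ∈ Set.Icc (a 0) (b 0),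
        ContinuousOn (fun t : Fin n → ℝ => f (Fin.cons s t)) S := fun s hs =>
      hf.comp (by fun_prop) fun t ht => cons_mem_pi_Icc hs ht
    obtain ⟨hint, hI⟩ := setIntegral_pi_Icc_succ hf
    rw [sum_prod_mul_fin_succ, hI]
    have hswap : ∫ x in Set.Icc (a 0) (b 0) ×ˢ S, f (Fin.cons x.1 x.2) ∂(volume.prod volume) =
        ∫ t in S, ∫ s in Set.Icc (a 0) (b 0), f (Fin.cons s t) := by
      rw [IntegrableOn, ← Measure.prod_restrict] at hint
      rw [← Measure.prod_restrict]
      exact integral_prod_symm _ hint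
    have hintS : Integrable (fun t => ∫ s in Set.Icc (a 0) (b 0), f (Fin.cons s t))
        (volume.restrict S) := by
      rw [IntegrableOn, ← Measure.prod_restrict] at hint
      exact hint.integral_prod_right
    rw [hswap]
    have hfirst : ∀ j₀ : Fin (m 0), ‖∑ j : (∀ p : Fin n, Fin (m p.succ)),
        ((∏ p, w p.succ (j p) : ℝ) : ℂ) * f (Fin.cons (x 0 j₀) fun p => x p.succ (j p)) -
          ∫ t in S, f (Fin.cons (x 0 j₀) t)‖ ≤ n * L ^ n * ε := by
      intro j₀
      refine ih (fun p => a p.succ) (fun p => b p.succ) (fun p => hab _) (fun p => hL' _)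
        (fun p => m p.succ) (fun p => w p.succ) (fun p => x p.succ) (fun p => hw _)
        (fun p => hws _) (fun p => hx _) (fun t => f (Fin.cons (x 0 j₀) t))
        (hcons _ (hx 0 j₀)) fun p t ht => ?_
      have := he p.succ _ (cons_mem_pi_Icc (hx 0 j₀) ht)
      simpa only [← Fin.cons_update] using this
    have hsecond : ‖(∑ j₀ : Fin (m 0), (w 0 j₀ : ℂ) * ∫ t in S, f (Fin.cons (x 0 j₀) t)) -
        ∫ t in S, ∫ s in Set.Icc (a 0) (b 0), f (Fin.cons s t)‖ ≤ ε * L ^ n := by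
      have h1 : ∑ j₀ : Fin (m 0), (w 0 j₀ : ℂ) * ∫ t in S, f (Fin.cons (x 0 j₀) t) =
          ∫ t in S, ∑ j₀ : Fin (m 0), (w 0 j₀ : ℂ) * f (Fin.cons (x 0 j₀) t) := by
        rw [integral_finsetSum]
        · simp only [integral_const_mul]
        · intro j₀ _
          exact ((hcons _ (hx 0 j₀)).integrableOn_compact hSc).const_mul _
      rw [h1, ← integral_sub _ hintS]
      · refine (norm_setIntegral_le_of_norm_le_const hSfin (C := ε) fun t ht => ?_).trans
          (mul_le_mul_of_nonneg_left hSvol hε)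
        have := he 0 (Fin.cons (a 0) t) (cons_mem_pi_Icc (Set.left_mem_Icc.2 (hab 0)) ht)
        simpa only [Fin.update_cons_zero] using this
      · exact integrable_finsetSum _ fun j₀ _ =>
          ((hcons _ (hx 0 j₀)).integrableOn_compact hSc).const_mul _
    have hL0 : 0 ≤ L := zero_le_one.trans hL
    refine (norm_sub_le_norm_sub_add_norm_sub _
      (∑ j₀ : Fin (m 0), (w 0 j₀ : ℂ) * ∫ t in S, f (Fin.cons (x 0 j₀) t)) _).trans ?_
    -- The inductive error is weighted by the rule in coordinate 0, of total weight at most L; the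
    -- error of that rule is integrated over a box of volume at most L^n.
    refine (add_le_add ?_ hsecond).trans (b := L * (n * L ^ n * ε) + ε * L ^ n) ?_
    · rw [← Finset.sum_sub_distrib]
      refine (norm_sum_le _ _).trans ?_
      calc _ ≤ ∑ j₀, w 0 j₀ * (n * L ^ n * ε) := by
            refine Finset.sum_le_sum fun j₀ _ => ?_
            rw [← mul_sub, norm_mul, Complex.norm_real, Real.norm_of_nonneg (hw 0 j₀)]
            exact mul_le_mul_of_nonneg_left (hfirst j₀) (hw 0 j₀)
        _ ≤ L * (n * L ^ n * ε) := by
            rw [← Finset.sum_mul]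
            exact mul_le_mul_of_nonneg_right (hws 0) (by positivity)
    · have h2 : ε * L ^ n ≤ ε * L ^ (n + 1) :=
        mul_le_mul_of_nonneg_left (pow_le_pow_right₀ hL n.le_succ) hε
      push_cast
      rw [pow_succ] at h2 ⊢
      nlinarith

/-! ### Jackson's theorem, and `C^{m,1}` functions along lines. -/

/-- Real part of a geometric sum over the powers of an M-th root of unity different from 1. -/
theorem sum_cos_mul_sub_eq_zero {M : ℕ} (n : ℤ) (hn : ¬ (M : ℤ) ∣ n) (θ : ℝ) :
    ∑ j ∈ Finset.range M, Real.cos (n * (θ - 2 * Real.pi * j / M)) = 0 := by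
  rcases Nat.eq_zero_or_pos M with rfl | hM
  · simp
  have hM' : (M : ℂ) ≠ 0 := by exact_mod_cast hM.ne'
  set ω : ℂ := Complex.exp (-(2 * Real.pi * Complex.I * (n / M)))
  have hω : ω ^ M = 1 := by
    rw [← Complex.exp_nat_mul, Complex.exp_eq_one_iff]
    refine ⟨-n, ?_⟩
    push_cast
    field_simp
  have hω1 : ω ≠ 1 := by
    intro h
    rw [Complex.exp_eq_one_iff] at h
    obtain ⟨k, hk⟩ := h
    apply hn
    refine ⟨-k, ?_⟩
    have hpi : (2 * Real.pi * Complex.I : ℂ) ≠ 0 := Complex.two_pi_I_ne_zero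
    have h2 : (n : ℂ) / M = -k := by
      apply mul_left_cancel₀ hpi
      linear_combination -hk
    rw [div_eq_iff hM'] at h2
    have h3 : (n : ℂ) = ((M * -k : ℤ) : ℂ) := by rw [h2]; push_cast; ring
    exact_mod_cast h3
  have hgeom : ∑ j ∈ Finset.range M, ω ^ j = 0 := by
    rw [geom_sum_eq hω1, hω, sub_self, zero_div]
  have hterm : ∀ j ∈ Finset.range M, Real.cos (n * (θ - 2 * Real.pi * j / M)) =
      (Complex.exp (n * θ * Complex.I) * ω ^ j).re := by
    intro j _
    rw [← Complex.exp_nat_mul, ← Complex.exp_add, ← Complex.exp_ofReal_mul_I_re]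
    congr 2
    push_cast
    ring
  rw [Finset.sum_congr rfl hterm, ← Complex.re_sum, ← Finset.mul_sum, hgeom, mul_zero,
    Complex.zero_re]

/-- The nonnegative trigonometric polynomial `|∑ k < m, s k * exp (i k t)| ^ 2`. -/
def squareKernel (m : ℕ) (s : ℕ → ℝ) (t : ℝ) : ℝ :=
  ∑ k ∈ Finset.range m, ∑ l ∈ Finset.range m, s k * s l * Real.cos (((k - l : ℤ) : ℝ) * t)

theorem squareKernel_nonneg (m : ℕ) (s : ℕ → ℝ) (t : ℝ) : 0 ≤ squareKernel m s t := by
  have : squareKernel m s t = (∑ k ∈ Finset.range m, s k * Real.cos (k * t)) ^ 2 +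
      (∑ k ∈ Finset.range m, s k * Real.sin (k * t)) ^ 2 := by
    rw [sq, sq, Finset.sum_mul_sum, Finset.sum_mul_sum, ← Finset.sum_add_distrib]
    refine Finset.sum_congr rfl fun k _ => ?_
    rw [← Finset.sum_add_distrib]
    refine Finset.sum_congr rfl fun l _ => ?_
    push_cast
    rw [sub_mul, Real.cos_sub]
    ring
  rw [this]
  positivity

/-- All frequencies satisfy |k - l| < m + 1, so the equispaced sum keeps only the diagonal k = l. -/
theorem sum_squareKernel (m : ℕ) (s : ℕ → ℝ) (θ : ℝ) :
    ∑ j ∈ Finset.range (m + 1), squareKernel m s (θ - 2 * Real.pi * j / (m + 1 : ℕ)) =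
      (m + 1) * ∑ k ∈ Finset.range m, s k ^ 2 := by
  unfold squareKernel
  rw [Finset.sum_comm, Finset.mul_sum]
  refine Finset.sum_congr rfl fun k hk => ?_
  rw [Finset.sum_comm, Finset.sum_eq_single_of_mem k hk]
  · simp [sq]
  · intro l hl hlk
    rw [← Finset.mul_sum, sum_cos_mul_sub_eq_zero, mul_zero]
    intro hd
    have := Int.eq_zero_of_abs_lt_dvd hd (by simp at hk hl; rw [abs_lt]; push_cast; omega)
    omega

/-- Multiplication by the cosine shifts frequencies by ±1, so the sum keeps only the pairs of
neighbours l = k ± 1. The recurrence with its boundary values says that s is an eigenvector, with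
eigenvalue 2c, of the adjacency matrix of a path, which evaluates this quadratic form. -/
theorem sum_cos_mul_squareKernel (m : ℕ) (s : ℕ → ℝ) (θ c : ℝ)
    (hs : ∀ k, k + 1 < m → s k + s (k + 2) = 2 * c * s (k + 1))
    (hs0 : 0 < m → s 1 = 2 * c * s 0) (hsm : s m = 0) :
    ∑ j ∈ Finset.range (m + 1), Real.cos (θ - 2 * Real.pi * j / (m + 1 : ℕ)) *
      squareKernel m s (θ - 2 * Real.pi * j / (m + 1 : ℕ)) =
      (m + 1) * (c * ∑ k ∈ Finset.range m, s k ^ 2) := by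
  have key : ∀ n : ℤ, ∀ t : ℝ, Real.cos t * Real.cos (n * t) =
      (Real.cos (((n + 1 : ℤ) : ℝ) * t) + Real.cos (((n - 1 : ℤ) : ℝ) * t)) / 2 := by
    intro n t
    push_cast
    rw [add_mul, sub_mul, Real.cos_add, Real.cos_sub, one_mul]
    ring
  have hsum : ∀ k ∈ Finset.range m, ∀ l ∈ Finset.range m,
      ∑ j ∈ Finset.range (m + 1), Real.cos (θ - 2 * Real.pi * j / (m + 1 : ℕ)) *
        (s k * s l * Real.cos (((k - l : ℤ) : ℝ) * (θ - 2 * Real.pi * j / (m + 1 : ℕ)))) =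
      (m + 1) * (s k * ((if l = k + 1 then s l else 0) + (if l + 1 = k then s l else 0)) / 2) := by
    intro k hk l hl
    simp only [Finset.mem_range] at hk hl
    simp only [mul_left_comm (Real.cos _) (s k * s l), key]
    rw [← Finset.mul_sum, ← Finset.sum_div, Finset.sum_add_distrib]
    have h0 : ∀ n : ℤ, |n| < m + 1 → ∑ j ∈ Finset.range (m + 1),
        Real.cos ((n : ℝ) * (θ - 2 * Real.pi * j / (m + 1 : ℕ))) = if n = 0 then (m + 1 : ℝ) else 0 := by
      intro n hn
      split_ifs with h
      · simp [h]
      · apply sum_cos_mul_sub_eq_zero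
        intro hd
        exact h (Int.eq_zero_of_abs_lt_dvd hd (by push_cast; exact hn))
    rw [h0 _ (by rw [abs_lt]; omega), h0 _ (by rw [abs_lt]; omega)]
    have e1 : ((k : ℤ) - l + 1 = 0) ↔ l = k + 1 := by omega
    have e2 : ((k : ℤ) - l - 1 = 0) ↔ l + 1 = k := by omega
    simp only [e1, e2]
    split_ifs <;> ring
  unfold squareKernel
  simp only [Finset.mul_sum]
  rw [Finset.sum_comm]
  refine Finset.sum_congr rfl fun k hk => ?_
  rw [Finset.sum_comm, Finset.sum_congr rfl (hsum k hk), ← Finset.mul_sum, ← Finset.sum_div,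
    ← Finset.mul_sum, Finset.sum_add_distrib]
  simp only [Finset.mem_range] at hk
  have f1 : ∑ l ∈ Finset.range m, (if l = k + 1 then s l else 0) = s (k + 1) := by
    rw [Finset.sum_ite_eq' (Finset.range m) (k + 1) s]
    split_ifs with h
    · rfl
    · have : k + 1 = m := by simp at h; omega
      rw [this, hsm]
  rw [f1]
  rcases k with _ | k
  · simp only [zero_add, hs0 hk, Nat.add_eq_zero_iff, one_ne_zero, and_false, if_false,
      Finset.sum_const_zero]
    ring
  · have f2 : ∑ l ∈ Finset.range m, (if l + 1 = k + 1 then s l else 0) = s k := by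
      simp only [add_left_inj]
      rw [Finset.sum_ite_eq' (Finset.range m) k s, if_pos (by simp; omega)]
    rw [f2, add_comm (s (k + 1 + 1)), hs k hk]
    ring

/-- The right side is the squared chord between two points of the unit circle, the left side its
horizontal projection. This reduces the second moment of the approximation weights to a cosine
moment. -/
theorem sq_cos_sub_cos_le (θ φ : ℝ) :
    (Real.cos θ - Real.cos φ) ^ 2 ≤ 2 * (1 - Real.cos (θ - φ)) := by
  rw [Real.cos_sub]
  nlinarith [sq_nonneg (Real.sin θ - Real.sin φ), Real.sin_sq_add_cos_sq θ,
    Real.sin_sq_add_cos_sq φ]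

/-- **Jackson's inequality** for Lipschitz functions of `cos θ`. -/
theorem exists_polynomial_cos_near (h : ℕ) (L : ℝ) (hL : 0 ≤ L) (g : ℝ → ℂ)
    (hg : ∀ x ∈ Set.Icc (-1 : ℝ) 1, ∀ y ∈ Set.Icc (-1 : ℝ) 1, ‖g x - g y‖ ≤ L * |x - y|) :
    ∃ P : ℂ[X], P.natDegree ≤ h ∧
      ∀ y ∈ Set.Icc (-1 : ℝ) 1, ‖g y - P.eval (y : ℂ)‖ ≤ L * (Real.pi / (h + 1)) := by
  -- The frequencies k - l with k, l < m then have modulus at most h, the allowed degree.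
  set m := h + 1 with hm
  set α : ℝ := Real.pi / (m + 1) with hα
  have hα0 : 0 < α := by positivity
  -- The sine eigenvector of the path on m vertices: it vanishes at k = m, and its eigenvalue 2 cos
  -- α makes the kernel concentrate at scale α.
  set s : ℕ → ℝ := fun k => Real.sin ((k + 1) * α) with hs
  set A : ℝ := ∑ k ∈ Finset.range m, s k ^ 2 with hA
  have hA0 : 0 < A := by
    refine lt_of_lt_of_le ?_ (Finset.single_le_sum (f := fun k => s k ^ 2)
      (fun k _ => sq_nonneg _) (show 0 ∈ Finset.range m by simp [hm]))
    have : 0 < s 0 := by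
      simp only [hs, Nat.cast_zero, zero_add, one_mul]
      refine Real.sin_pos_of_pos_of_lt_pi hα0 ?_
      rw [hα, div_lt_iff₀ (by positivity)]
      have : (1 : ℝ) ≤ m := by rw [hm]; push_cast; linarith [(Nat.cast_nonneg h : (0 : ℝ) ≤ h)]
      nlinarith [Real.pi_pos]
    positivity
  set φ : ℕ → ℝ := fun j => 2 * Real.pi * j / (m + 1 : ℕ) with hφ
  set K := squareKernel m s with hK
  have hrec : ∀ x : ℝ, Real.sin (x - α) + Real.sin (x + α) = 2 * Real.cos α * Real.sin x := by
    intro x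
    rw [Real.sin_sub, Real.sin_add]
    ring
  have hK1 : ∀ θ, ∑ j ∈ Finset.range (m + 1), K (θ - φ j) = (m + 1) * A :=
    fun θ => sum_squareKernel m s θ
  have hK2 : ∀ θ, ∑ j ∈ Finset.range (m + 1), Real.cos (θ - φ j) * K (θ - φ j) =
      (m + 1) * (Real.cos α * A) := by
    intro θ
    refine sum_cos_mul_squareKernel m s θ (Real.cos α) ?_ ?_ ?_
    · intro k _
      have := hrec ((k + 1 + 1) * α)
      simp only [hs]
      push_cast
      rw [← this]
      congr 2 <;> ring
    · intro _
      have := hrec α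
      simp only [hs]
      push_cast
      rw [sub_self, Real.sin_zero, zero_add] at this
      rw [zero_add, one_mul, ← this]
      congr 1; ring
    · simp only [hs, hα]
      rw [mul_div_cancel₀]
      · exact Real.sin_pi
      · positivity
  set D : ℝ := 2 * (m + 1) * A with hD
  have hD0 : 0 < D := by positivity
  -- Symmetrising in θ makes the weights even, hence polynomials in cos θ; they are nonnegative and
  -- sum to 1.
  let W : ℝ → ℕ → ℝ := fun θ j => (K (θ - φ j) + K (-θ - φ j)) / D
  have hW0 : ∀ θ j, 0 ≤ W θ j := fun θ j =>
    div_nonneg (add_nonneg (squareKernel_nonneg _ _ _) (squareKernel_nonneg _ _ _)) hD0.le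
  have hW1 : ∀ θ, ∑ j ∈ Finset.range (m + 1), W θ j = 1 := by
    intro θ
    simp only [W]
    rw [← Finset.sum_div, Finset.sum_add_distrib, hK1, hK1, div_eq_one_iff_eq hD0.ne', hD]
    ring
  have hW2 : ∀ θ, ∑ j ∈ Finset.range (m + 1), W θ j * (Real.cos θ - Real.cos (φ j)) ^ 2 ≤
      α ^ 2 := by
    intro θ
    have h1 : ∀ j ∈ Finset.range (m + 1), W θ j * (Real.cos θ - Real.cos (φ j)) ^ 2 ≤
        2 * ((K (θ - φ j) - Real.cos (θ - φ j) * K (θ - φ j)) +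
          (K (-θ - φ j) - Real.cos (-θ - φ j) * K (-θ - φ j))) / D := by
      intro j _
      simp only [W]
      rw [div_mul_eq_mul_div, div_le_div_iff_of_pos_right hD0]
      have h2 := sq_cos_sub_cos_le θ (φ j)
      have h3 := sq_cos_sub_cos_le (-θ) (φ j)
      rw [Real.cos_neg] at h3
      have h4 := mul_le_mul_of_nonneg_left h2 (squareKernel_nonneg m s (θ - φ j))
      have h5 := mul_le_mul_of_nonneg_left h3 (squareKernel_nonneg m s (-θ - φ j))
      simp only [hK]
      linarith
    refine (Finset.sum_le_sum h1).trans ?_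
    rw [← Finset.sum_div, ← Finset.mul_sum, Finset.sum_add_distrib, Finset.sum_sub_distrib,
      Finset.sum_sub_distrib, hK1, hK1, hK2, hK2, div_le_iff₀ hD0, hD]
    have h6 := Real.one_sub_sq_div_two_le_cos (x := α)
    have h7 : 2 * (1 - Real.cos α) ≤ α ^ 2 := by linarith
    have h8 := mul_le_mul_of_nonneg_right h7 (show 0 ≤ 2 * (m + 1) * A by positivity)
    linarith
  have hW3 : ∀ θ, ∑ j ∈ Finset.range (m + 1), W θ j * |Real.cos θ - Real.cos (φ j)| ≤ α := by
    intro θ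
    have h1 : ∀ j ∈ Finset.range (m + 1), W θ j * |Real.cos θ - Real.cos (φ j)| ≤
        (W θ j * (Real.cos θ - Real.cos (φ j)) ^ 2 / α + W θ j * α) / 2 := by
      intro j _
      rw [← sq_abs (Real.cos θ - Real.cos (φ j))]
      set d := |Real.cos θ - Real.cos (φ j)|
      -- This pointwise AM-GM replaces Cauchy-Schwarz in passing from the second moment to the
      -- first.
      have h2 : d ≤ (d ^ 2 / α + α) / 2 := by
        rw [le_div_iff₀ two_pos, div_add' _ _ _ hα0.ne', le_div_iff₀ hα0]
        nlinarith [sq_nonneg (d - α)]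
      calc W θ j * d ≤ W θ j * ((d ^ 2 / α + α) / 2) := mul_le_mul_of_nonneg_left h2 (hW0 θ j)
        _ = _ := by ring
    refine (Finset.sum_le_sum h1).trans ?_
    rw [← Finset.sum_div, Finset.sum_add_distrib, ← Finset.sum_div, ← Finset.sum_mul, hW1]
    have h3 : (∑ j ∈ Finset.range (m + 1), W θ j * (Real.cos θ - Real.cos (φ j)) ^ 2) / α ≤ α := by
      rw [div_le_iff₀ hα0, ← sq]
      exact hW2 θ
    linarith
  refine ⟨∑ j ∈ Finset.range (m + 1), ∑ k ∈ Finset.range m, ∑ l ∈ Finset.range m,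
    C (g (Real.cos (φ j)) * ((2 * (s k * s l * Real.cos (((k - l : ℤ) : ℝ) * φ j)) / D : ℝ) : ℂ)) *
      Chebyshev.T ℂ (k - l : ℤ), ?_, ?_⟩
  · refine natDegree_sum_le_of_forall_le _ _ fun j _ => natDegree_sum_le_of_forall_le _ _
      fun k hk => natDegree_sum_le_of_forall_le _ _ fun l hl => ?_
    refine (natDegree_C_mul_le _ _).trans ?_
    rw [Chebyshev.natDegree_T]
    simp only [Finset.mem_range] at hk hl
    omega
  · intro y hy
    obtain ⟨θ, rfl⟩ : ∃ θ, y = Real.cos θ := ⟨Real.arccos y, (Real.cos_arccos hy.1 hy.2).symm⟩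
    have hev : (∑ j ∈ Finset.range (m + 1), ∑ k ∈ Finset.range m, ∑ l ∈ Finset.range m,
        C (g (Real.cos (φ j)) *
          ((2 * (s k * s l * Real.cos (((k - l : ℤ) : ℝ) * φ j)) / D : ℝ) : ℂ)) *
        Chebyshev.T ℂ (k - l : ℤ)).eval ((Real.cos θ : ℝ) : ℂ) =
        ∑ j ∈ Finset.range (m + 1), g (Real.cos (φ j)) * (W θ j : ℂ) := by
      simp only [eval_finsetSum, eval_mul, eval_C]
      refine Finset.sum_congr rfl fun j _ => ?_
      simp only [mul_assoc, ← Finset.mul_sum]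
      congr 1
      simp only [W, hK, squareKernel]
      rw [← Finset.sum_add_distrib, Finset.sum_div]
      push_cast
      refine Finset.sum_congr rfl fun k _ => ?_
      rw [← Finset.sum_add_distrib, Finset.sum_div]
      refine Finset.sum_congr rfl fun l _ => ?_
      rw [Chebyshev.T_complex_cos]
      push_cast
      rw [mul_sub ((k : ℂ) - l), mul_sub ((k : ℂ) - l), Complex.cos_sub, Complex.cos_sub, mul_neg,
        Complex.cos_neg, Complex.sin_neg]
      ring
    rw [hev]
    have h1 : g (Real.cos θ) - ∑ j ∈ Finset.range (m + 1), g (Real.cos (φ j)) * (W θ j : ℂ) =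
        ∑ j ∈ Finset.range (m + 1), (g (Real.cos θ) - g (Real.cos (φ j))) * (W θ j : ℂ) := by
      simp only [sub_mul]
      rw [Finset.sum_sub_distrib, ← Finset.mul_sum, ← Complex.ofReal_sum, hW1, Complex.ofReal_one,
        mul_one]
    rw [h1]
    refine (norm_sum_le _ _).trans ?_
    have h2 : ∀ j ∈ Finset.range (m + 1), ‖(g (Real.cos θ) - g (Real.cos (φ j))) * (W θ j : ℂ)‖ ≤
        L * (W θ j * |Real.cos θ - Real.cos (φ j)|) := by
      intro j _
      rw [norm_mul, Complex.norm_real, Real.norm_of_nonneg (hW0 θ j)]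
      have := mul_le_mul_of_nonneg_right (hg _ (Real.cos_mem_Icc θ) _ (Real.cos_mem_Icc (φ j)))
        (hW0 θ j)
      linarith
    refine (Finset.sum_le_sum h2).trans ?_
    rw [← Finset.mul_sum]
    refine mul_le_mul_of_nonneg_left ((hW3 θ).trans ?_) hL
    rw [hα, hm]
    gcongr
    linarith

/-- **Jackson's inequality** for Lipschitz functions on an interval. -/
theorem exists_polynomial_near_of_lipschitz {a b : ℝ} (hab : a < b) (h : ℕ) (L : ℝ) (hL : 0 ≤ L)
    (f : ℝ → ℂ) (hf : ∀ x ∈ Set.Icc a b, ∀ y ∈ Set.Icc a b, ‖f x - f y‖ ≤ L * |x - y|) :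
    ∃ P : ℂ[X], P.natDegree ≤ h ∧
      ∀ x ∈ Set.Icc a b, ‖f x - P.eval (x : ℂ)‖ ≤ (b - a) / 2 * Real.pi * L / (h + 1) := by
  have hd : 0 < (b - a) / 2 := by linarith
  have hmem : ∀ y ∈ Set.Icc (-1 : ℝ) 1, (a + b) / 2 + (b - a) / 2 * y ∈ Set.Icc a b := by
    intro y hy
    constructor <;> nlinarith [hy.1, hy.2]
  obtain ⟨P, hP, hPe⟩ := exists_polynomial_cos_near h ((b - a) / 2 * L) (by positivity)
    (fun y => f ((a + b) / 2 + (b - a) / 2 * y)) (by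
      intro x hx y hy
      refine (hf _ (hmem x hx) _ (hmem y hy)).trans (le_of_eq ?_)
      rw [add_sub_add_left_eq_sub, ← mul_sub, abs_mul, abs_of_pos hd]
      ring)
  refine ⟨P.comp (C ((2 / (b - a) : ℝ) : ℂ) * (X - C (((a + b) / 2 : ℝ) : ℂ))), ?_, ?_⟩
  · rw [natDegree_comp]
    have : (C ((2 / (b - a) : ℝ) : ℂ) * (X - C (((a + b) / 2 : ℝ) : ℂ))).natDegree ≤ 1 :=
      (natDegree_C_mul_le _ _).trans (by rw [natDegree_X_sub_C])
    nlinarith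
  · intro x hx
    have hy : 2 / (b - a) * (x - (a + b) / 2) ∈ Set.Icc (-1 : ℝ) 1 := by
      have h0 : 0 < b - a := by linarith
      rw [div_mul_eq_mul_div]
      constructor
      · rw [le_div_iff₀ h0]; linarith [hx.1]
      · rw [div_le_iff₀ h0]; linarith [hx.2]
    have := hPe _ hy
    have hx' : (a + b) / 2 + (b - a) / 2 * (2 / (b - a) * (x - (a + b) / 2)) = x := by
      have : b - a ≠ 0 := by linarith
      field_simp
      ring
    simp only [hx'] at this
    have he : (P.comp (C ((2 / (b - a) : ℝ) : ℂ) * (X - C (((a + b) / 2 : ℝ) : ℂ)))).eval (x : ℂ) =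
        P.eval ((2 / (b - a) * (x - (a + b) / 2) : ℝ) : ℂ) := by
      simp only [eval_comp, eval_mul, eval_C, eval_sub, eval_X]
      push_cast
      rfl
    rw [he]
    refine this.trans (le_of_eq ?_)
    ring

/-- `f` is `m` times differentiable on `[a, b]`, its derivatives up to order `m` are bounded by `M`
and the derivative of order `m` has Lipschitz constant `M`. -/
def HasLipDerivs (a b M : ℝ) : ℕ → (ℝ → ℂ) → Prop
  | 0, f => (∀ x ∈ Set.Icc a b, ‖f x‖ ≤ M) ∧
      ∀ x ∈ Set.Icc a b, ∀ y ∈ Set.Icc a b, ‖f x - f y‖ ≤ M * |x - y|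
  | m + 1, f => (∀ x ∈ Set.Icc a b, ‖f x‖ ≤ M) ∧
      ∃ g, (∀ x ∈ Set.Icc a b, HasDerivWithinAt f (g x) (Set.Icc a b) x) ∧ HasLipDerivs a b M m g

theorem exists_antiderivative (P : ℂ[X]) {h : ℕ} (hP : P.natDegree ≤ h) :
    ∃ R : ℂ[X], derivative R = P ∧ R.natDegree ≤ h + 1 := by
  refine ⟨∑ k ∈ Finset.range (h + 1), C (P.coeff k / ((k + 1 : ℕ) : ℂ)) * X ^ (k + 1), ?_, ?_⟩
  · rw [derivative_sum]
    conv_rhs => rw [P.as_sum_range_C_mul_X_pow' (Nat.lt_succ_of_le hP)]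
    refine Finset.sum_congr rfl fun k _ => ?_
    rw [derivative_C_mul_X_pow, div_mul_cancel₀, Nat.add_sub_cancel]
    exact_mod_cast Nat.succ_ne_zero k
  · refine natDegree_sum_le_of_forall_le _ _ fun k hk => ?_
    refine (natDegree_C_mul_X_pow_le _ _).trans ?_
    simp only [Finset.mem_range] at hk
    omega

/-- **Jackson's theorem** for functions of class `C^{m,1}`. -/
theorem HasLipDerivs.exists_polynomial_near {a b : ℝ} (hab : a < b) (m : ℕ) :
    ∃ c : ℝ, 0 ≤ c ∧ ∀ M : ℝ, 0 ≤ M → ∀ f, HasLipDerivs a b M m f → ∀ h : ℕ,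
      ∃ P : ℂ[X], P.natDegree ≤ h ∧
        ∀ x ∈ Set.Icc a b, ‖f x - P.eval (x : ℂ)‖ ≤ c * M / ((h : ℝ) + 1) ^ (m + 1) := by
  have hd : 0 < (b - a) / 2 := by linarith
  induction m with
  | zero =>
    refine ⟨(b - a) / 2 * Real.pi, by positivity, fun M hM f hf h => ?_⟩
    obtain ⟨P, hP, hPe⟩ := exists_polynomial_near_of_lipschitz hab h M hM f hf.2
    exact ⟨P, hP, fun x hx => by simpa using hPe x hx⟩
  | succ m ih =>
    obtain ⟨c, hc, ih⟩ := ih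
    set κ := (b - a) / 2 * Real.pi with hκ
    have hκ0 : 0 < κ := by positivity
    refine ⟨max 1 (κ * c * 2 ^ (m + 1)), by positivity, fun M hM f hf h => ?_⟩
    obtain ⟨hfM, g, hfg, hg⟩ := hf
    -- For degree 0 there is no room to integrate an approximant of f'; the zero polynomial and the
    -- bound on f itself suffice.
    rcases h with _ | h
    · refine ⟨0, by simp, fun x hx => ?_⟩
      simp only [eval_zero, sub_zero, Nat.cast_zero, zero_add, one_pow, div_one]
      exact (hfM x hx).trans (le_mul_of_one_le_left hM (le_max_left _ _))
    · obtain ⟨P, hP, hPe⟩ := ih M hM g hg h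
      obtain ⟨R, hR, hRd⟩ := exists_antiderivative P hP
      have hder : ∀ x ∈ Set.Icc a b, HasDerivWithinAt (fun x : ℝ => f x - R.eval (x : ℂ))
          (g x - P.eval (x : ℂ)) (Set.Icc a b) x := by
        intro x hx
        refine (hfg x hx).sub ?_
        rw [← hR]
        exact (R.hasDerivAt (x : ℂ)).comp_ofReal.hasDerivWithinAt
      -- R is an antiderivative of an approximant of f', so f - R has a small Lipschitz constant,
      -- and one more use of the Lipschitz case gains a factor 1/(h + 2).
      obtain ⟨S, hS, hSe⟩ := exists_polynomial_near_of_lipschitz hab (h + 1)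
        (c * M / ((h : ℝ) + 1) ^ (m + 1)) (by positivity) (fun x : ℝ => f x - R.eval (x : ℂ))
        (fun x hx y hy => by
          have := (convex_Icc a b).norm_image_sub_le_of_norm_hasDerivWithin_le hder hPe hy hx
          rwa [Real.norm_eq_abs] at this)
      refine ⟨R + S, (natDegree_add_le _ _).trans (max_le hRd hS), fun x hx => ?_⟩
      rw [eval_add, ← sub_sub]
      refine (hSe x hx).trans ?_
      push_cast
      have h1 : (0 : ℝ) < (h : ℝ) + 1 := by positivity
      have h2 : ((h : ℝ) + 1 + 1) ^ (m + 1) ≤ 2 ^ (m + 1) * ((h : ℝ) + 1) ^ (m + 1) := by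
        rw [← mul_pow]
        gcongr
        linarith
      calc κ * (c * M / ((h : ℝ) + 1) ^ (m + 1)) / ((h : ℝ) + 1 + 1)
          = κ * c * M / (((h : ℝ) + 1) ^ (m + 1) * ((h : ℝ) + 1 + 1)) := by
            field_simp
        _ ≤ κ * c * 2 ^ (m + 1) * M / ((h : ℝ) + 1 + 1) ^ (m + 1 + 1) := by
            rw [div_le_div_iff₀ (by positivity) (by positivity), pow_succ _ (m + 1)]
            have h3 := mul_le_mul_of_nonneg_left h2
              (show 0 ≤ κ * c * M * ((h : ℝ) + 1 + 1) by positivity)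
            linarith
        _ ≤ _ := by
            gcongr
            exact le_max_right _ _

/-- Derivatives along a line are the iterated derivatives of F evaluated on copies of its direction.
Compactness bounds them, so one M serves all base points; horizontal, vertical and diagonal lines
will be used. -/
theorem IsCLip.exists_hasLipDerivs {m : ℕ} {F : ℝ × ℝ → ℂ} {S : Set (ℝ × ℝ)} (hS : IsCompact S)
    (hSu : UniqueDiffOn ℝ S) (hF : IsCLip m F S) :
    ∃ M : ℝ, 0 ≤ M ∧ ∀ (q v : ℝ × ℝ) (a b : ℝ), ‖v‖ ≤ 1 → (∀ t ∈ Set.Icc a b, q + t • v ∈ S) →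
      HasLipDerivs a b M m (fun t => F (q + t • v)) := by
  obtain ⟨hF, L, hL⟩ := hF
  have hbd : ∀ r : ℕ, ∃ B : ℝ, 0 ≤ B ∧
      (r ≤ m → ∀ x ∈ S, ‖iteratedFDerivWithin ℝ r F S x‖ ≤ B) := by
    intro r
    by_cases hr : r ≤ m
    · obtain ⟨B, hB⟩ := hS.exists_bound_of_continuousOn
        (hF.continuousOn_iteratedFDerivWithin (by exact_mod_cast hr) hSu)
      exact ⟨max B 0, le_max_right _ _, fun _ x hx => (hB x hx).trans (le_max_left _ _)⟩
    · exact ⟨0, le_rfl, fun h => absurd h hr⟩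
  choose B hB0 hB using hbd
  have hsum : 0 ≤ ∑ r ∈ Finset.range (m + 1), B r := Finset.sum_nonneg fun r _ => hB0 r
  refine ⟨∑ r ∈ Finset.range (m + 1), B r + L, by positivity, fun q v a b hv hq => ?_⟩
  set M := ∑ r ∈ Finset.range (m + 1), B r + L with hM
  have hLM : (L : ℝ) ≤ M := by linarith
  have hBM : ∀ r ≤ m, ∀ x ∈ S, ‖iteratedFDerivWithin ℝ r F S x‖ ≤ M := by
    intro r hr x hx
    have h1 := Finset.single_le_sum (f := B) (fun r _ => hB0 r)
      (Finset.mem_range.2 (Nat.lt_succ_of_le hr))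
    have h2 := hB r hr x hx
    have h3 : (0 : ℝ) ≤ L := L.2
    linarith
  have hone : ∀ r : ℕ, ∀ A : ContinuousMultilinearMap ℝ (fun _ : Fin r => ℝ × ℝ) ℂ,
      ‖A fun _ => v‖ ≤ ‖A‖ := by
    intro r A
    refine (A.le_opNorm _).trans (mul_le_of_le_one_right (norm_nonneg _) ?_)
    exact Finset.prod_le_one (fun _ _ => norm_nonneg _) fun _ _ => hv
  -- Downward induction on the order r: j = m - r derivatives are still available.
  have key : ∀ j r : ℕ, r + j = m →
      HasLipDerivs a b M j (fun t => iteratedFDerivWithin ℝ r F S (q + t • v) fun _ => v) := by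
    intro j
    induction j with
    | zero =>
      intro r hr
      obtain rfl : r = m := by omega
      refine ⟨fun x hx => (hone _ _).trans (hBM _ le_rfl _ (hq x hx)), fun x hx y hy => ?_⟩
      rw [← sub_apply]
      refine (hone _ _).trans ?_
      have h1 := hL.norm_sub_le (hq x hx) (hq y hy)
      refine h1.trans ?_
      rw [add_sub_add_left_eq_sub, ← sub_smul, norm_smul, Real.norm_eq_abs]
      exact mul_le_mul hLM (mul_le_of_le_one_right (abs_nonneg _) hv) (by positivity) (by positivity)
    | succ j ih =>
      intro r hr
      refine ⟨fun x hx => (hone _ _).trans (hBM _ (by omega) _ (hq x hx)), _, fun x hx => ?_,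
        ih (r + 1) (by omega)⟩
      have h1 : HasFDerivWithinAt (iteratedFDerivWithin ℝ r F S)
          (fderivWithin ℝ (iteratedFDerivWithin ℝ r F S) S (q + x • v)) S (q + x • v) :=
        ((hF.differentiableOn_iteratedFDerivWithin (by exact_mod_cast (by omega : r < m)) hSu) _
          (hq x hx)).hasFDerivWithinAt
      have h2 : HasDerivWithinAt (fun t : ℝ => q + t • v) v (Set.Icc a b) x := by
        have := ((hasDerivWithinAt_id x (Set.Icc a b)).smul_const v).const_add q
        simpa using this
      have h3 := h1.comp_hasDerivWithinAt x h2 hq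
      have h4 := (ContinuousMultilinearMap.apply ℝ (fun _ : Fin r => ℝ × ℝ) ℂ
        (fun _ => v)).hasFDerivAt.comp_hasDerivWithinAt x h3
      exact h4
  have := key m 0 (by omega)
  simpa using this

/-! ### Bernstein's theorem on ellipses. -/

/-- Laurent expansion on the unit circle of a bounded holomorphic function on an annulus. -/
theorem exists_hasSum_laurent_of_bounded {ρ B : ℝ} (hρ : 1 < ρ) (g : ℂ → ℂ)
    (hg : ∀ w : ℂ, ρ⁻¹ < ‖w‖ → ‖w‖ < ρ → DifferentiableAt ℂ g w ∧ ‖g w‖ ≤ B) :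
    ∃ c : ℤ → ℂ, (∀ n : ℕ, ‖c n‖ ≤ B * ρ⁻¹ ^ n ∧ ‖c (-n)‖ ≤ B * ρ⁻¹ ^ n) ∧
      ∀ θ : ℝ, HasSum (fun n : ℤ => c n * Complex.exp (n * θ * Complex.I))
        (g (Complex.exp (θ * Complex.I))) := by
  have : Fact (0 < 2 * Real.pi) := ⟨Real.two_pi_pos⟩
  have hρ0 : 0 < ρ := by linarith
  have hρ1 : ρ⁻¹ < 1 := inv_lt_one_of_one_lt₀ hρ
  have hρ' : 0 < ρ⁻¹ := inv_pos.2 hρ0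
  have hB : 0 ≤ B := (norm_nonneg _).trans (hg 1 (by simpa using hρ1) (by simpa using hρ)).2
  have hcircle : ∀ x : ℝ, ((AddCircle.toCircle (x : AddCircle (2 * Real.pi)) : Circle) : ℂ) =
      Complex.exp (x * Complex.I) := by
    intro x
    rw [AddCircle.toCircle_apply_mk, div_self Real.two_pi_pos.ne', one_mul, Circle.coe_exp]
  have hfour : ∀ (n : ℤ) (x : ℝ), (fourier n (x : AddCircle (2 * Real.pi)) : ℂ) =
      Complex.exp (n * x * Complex.I) := by
    intro n x
    rw [fourier_coe_apply]
    congr 1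
    have : (Real.pi : ℂ) ≠ 0 := by exact_mod_cast Real.pi_ne_zero
    push_cast
    field_simp
  let G : C(AddCircle (2 * Real.pi), ℂ) :=
    ⟨fun x => g (AddCircle.toCircle x : Circle), by
      rw [continuous_iff_continuousAt]
      intro x
      have h1 : ‖((AddCircle.toCircle x : Circle) : ℂ)‖ = 1 := Circle.norm_coe _
      have h2 : ContinuousAt g (AddCircle.toCircle x : Circle) :=
        (hg _ (by rw [h1]; exact hρ1) (by rw [h1]; exact hρ)).1.continuousAt
      exact h2.comp (f := fun x : AddCircle (2 * Real.pi) => ((AddCircle.toCircle x : Circle) : ℂ))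
        (continuous_subtype_val.comp AddCircle.continuous_toCircle).continuousAt⟩
  set c : ℤ → ℂ := fourierCoeff G with hc
  -- Writing the Fourier coefficient as a contour integral allows its circle to be moved within the
  -- annulus.
  have hcint : ∀ n : ℤ, c n = (2 * Real.pi * Complex.I : ℂ)⁻¹ •
      ∮ z in C(0, 1), (z - 0)⁻¹ • (z ^ (-n) * g z) := by
    intro n
    rw [hc, fourierCoeff_eq_intervalIntegral _ n 0, zero_add, circleIntegral]
    have : ∀ θ : ℝ, deriv (circleMap 0 1) θ •
        ((circleMap 0 1 θ - 0)⁻¹ • (circleMap 0 1 θ ^ (-n) * g (circleMap 0 1 θ))) =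
        Complex.I * ((fourier (-n) (θ : AddCircle (2 * Real.pi)) : ℂ) • G θ) := by
      intro θ
      have h1 : circleMap 0 1 θ = Complex.exp (θ * Complex.I) := by simp [circleMap]
      have h2 : G θ = g (Complex.exp (θ * Complex.I)) := by
        rw [← hcircle]; rfl
      rw [deriv_circleMap, h1, h2, hfour, sub_zero, ← Complex.exp_int_mul]
      simp only [smul_eq_mul]
      rw [← mul_assoc, mul_right_comm (Complex.exp (θ * Complex.I)), mul_inv_cancel₀
        (Complex.exp_ne_zero _), one_mul]
      congr 3
      ring
    simp only [this]
    rw [intervalIntegral.integral_const_mul, mul_inv, smul_eq_mul, mul_assoc, inv_mul_cancel_left₀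
      Complex.I_ne_zero, Complex.real_smul]
    push_cast
    rw [one_div]
  have hann : ∀ (n : ℤ) (w : ℂ), ρ⁻¹ < ‖w‖ → ‖w‖ < ρ →
      DifferentiableAt ℂ (fun z => z ^ (-n) * g z) w := fun n w h1 h2 =>
    (differentiableAt_zpow.2 (Or.inl (norm_pos_iff.1 (hρ'.trans h1)))).mul (hg w h1 h2).1
  have hshift : ∀ (n : ℤ) (r R : ℝ), ρ⁻¹ < r → r ≤ R → R < ρ →
      (∮ z in C(0, R), (z - 0)⁻¹ • (z ^ (-n) * g z)) =
      ∮ z in C(0, r), (z - 0)⁻¹ • (z ^ (-n) * g z) := by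
    intro n r R hr hrR hR
    refine Complex.circleIntegral_sub_center_inv_smul_eq_of_differentiable_on_annulus_off_countable
      (hρ'.trans hr) hrR Set.countable_empty ?_ ?_
    · intro z hz
      simp only [Set.mem_sdiff, mem_closedBall_zero_iff, mem_ball_zero_iff, not_lt] at hz
      exact (hann n z (hr.trans_le hz.2) (hz.1.trans_lt hR)).continuousAt.continuousWithinAt
    · intro z hz
      simp only [Set.mem_sdiff, mem_closedBall_zero_iff, mem_ball_zero_iff, not_le,
        Set.mem_empty_iff_false, not_false_iff, and_true] at hz
      exact hann n z (hr.trans hz.2) (hz.1.trans hR)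
  have hbound : ∀ (n : ℤ) (r : ℝ), ρ⁻¹ < r → r < ρ → ‖c n‖ ≤ B * r ^ (-n) := by
    intro n r hr hrρ
    have hr0 : 0 < r := hρ'.trans hr
    have h1 : c n = (2 * Real.pi * Complex.I : ℂ)⁻¹ •
        ∮ z in C(0, r), (z - 0)⁻¹ • (z ^ (-n) * g z) := by
      rw [hcint]
      rcases le_total r 1 with h | h
      · rw [hshift n r 1 hr h hρ]
      · rw [hshift n 1 r hρ1 h hrρ]
    rw [h1]
    refine (circleIntegral.norm_two_pi_i_inv_smul_integral_le_of_norm_le_const hr0.le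
      (C := r⁻¹ * (r ^ (-n) * B)) fun z hz => ?_).trans (le_of_eq ?_)
    · rw [mem_sphere_zero_iff_norm] at hz
      rw [norm_smul, norm_mul, norm_inv, norm_zpow, sub_zero, hz]
      gcongr
      exact (hg z (hz ▸ hr) (hz ▸ hrρ)).2
    · rw [mul_inv_cancel_left₀ hr0.ne', mul_comm]
  -- The annulus is open, so the bounds at the radii ρ and ρ⁻¹ are obtained only as limits.
  have hlim : ∀ (n : ℤ) (R : ℝ) (l : Filter ℝ), l.NeBot → R ≠ 0 → l ≤ nhds R →
      Set.Ioo ρ⁻¹ ρ ∈ l → ‖c n‖ ≤ B * R ^ (-n) := by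
    intro n R l hl hR hlR hmem
    refine ge_of_tendsto (x := l) (f := fun r : ℝ => B * r ^ (-n)) ?_ ?_
    · exact (((continuousAt_zpow₀ R (-n) (Or.inl hR)).tendsto.mono_left hlR)).const_mul B
    · filter_upwards [hmem] with r hr using hbound n r hr.1 hr.2
  have hlt : ρ⁻¹ < ρ := hρ1.trans hρ
  have hcn : ∀ n : ℕ, ‖c n‖ ≤ B * ρ⁻¹ ^ n := by
    intro n
    have := hlim n ρ (nhdsWithin ρ (Set.Iio ρ)) inferInstance hρ0.ne' nhdsWithin_le_nhds
      (Ioo_mem_nhdsLT hlt)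
    simpa using this
  have hcn' : ∀ n : ℕ, ‖c (-n)‖ ≤ B * ρ⁻¹ ^ n := by
    intro n
    have := hlim (-n) ρ⁻¹ (nhdsWithin ρ⁻¹ (Set.Ioi ρ⁻¹)) inferInstance hρ'.ne' nhdsWithin_le_nhds
      (Ioo_mem_nhdsGT hlt)
    simpa using this
  have hsum : Summable c := by
    have hgeo : Summable fun n : ℕ => B * ρ⁻¹ ^ n :=
      (summable_geometric_of_lt_one hρ'.le hρ1).mul_left B
    exact Summable.of_nat_of_neg (Summable.of_norm_bounded hgeo hcn)
      (Summable.of_norm_bounded hgeo hcn')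
  refine ⟨c, fun n => ⟨hcn n, hcn' n⟩, fun θ => ?_⟩
  have := has_pointwise_sum_fourier_series_of_summable hsum (θ : AddCircle (2 * Real.pi))
  have h2 : G θ = g (Complex.exp (θ * Complex.I)) := by
    rw [← hcircle]; rfl
  rw [h2] at this
  simpa only [hfour, smul_eq_mul] using this

theorem joukowski_mem_bernsteinEllipse {a b ρ : ℝ} (hab : a < b) {w : ℂ}
    (h1 : ρ⁻¹ < ‖w‖) (h2 : ‖w‖ < ρ) (hρ : 1 < ρ) :
    ((a + b) / 2 + (b - a) / 4 * (w + w⁻¹) : ℂ) ∈ bernsteinEllipse a b ρ := by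
  have hρ0 : 0 < ρ := by linarith
  have hr : 0 < ‖w‖ := (inv_pos.2 hρ0).trans h1
  have hw : w ≠ 0 := norm_pos_iff.1 hr
  have hd : 0 < (b - a) / 4 := by linarith
  have hdn : ‖((b - a) / 4 : ℂ)‖ = (b - a) / 4 := by
    rw [← Complex.ofReal_sub, show (4 : ℂ) = ((4 : ℝ) : ℂ) by norm_num, ← Complex.ofReal_div,
      Complex.norm_real, Real.norm_of_nonneg hd.le]
  have e1 : ((a + b) / 2 + (b - a) / 4 * (w + w⁻¹) : ℂ) - a = (b - a) / 4 * ((w + 1) ^ 2 / w) := by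
    field_simp
    ring
  have e2 : ((a + b) / 2 + (b - a) / 4 * (w + w⁻¹) : ℂ) - b = (b - a) / 4 * ((w - 1) ^ 2 / w) := by
    field_simp
    ring
  simp only [bernsteinEllipse, Set.mem_ofPred_eq, dist_eq_norm]
  rw [e1, e2, norm_mul, norm_mul, norm_div (_ ^ 2), norm_div (_ ^ 2), norm_pow, norm_pow, hdn]
  -- The distances to the foci are proportional to |w + 1|²/|w| and |w - 1|²/|w|, so the
  -- parallelogram law turns their sum into a multiple of |w| + 1/|w|.
  have hpar := parallelogram_law_with_norm ℝ w 1
  rw [norm_one] at hpar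
  have h3 : ‖w + 1‖ ^ 2 / ‖w‖ + ‖w - 1‖ ^ 2 / ‖w‖ < 2 * (ρ + ρ⁻¹) := by
    rw [← add_div, div_lt_iff₀ hr]
    have h4 : 0 < (ρ - ‖w‖) * (‖w‖ - ρ⁻¹) := mul_pos (sub_pos.2 h2) (sub_pos.2 h1)
    have h5 : ρ * ρ⁻¹ = 1 := mul_inv_cancel₀ hρ0.ne'
    nlinarith
  rw [← mul_add]
  nlinarith

theorem ofReal_mem_bernsteinEllipse {a b ρ x : ℝ} (hab : a < b) (hρ : 1 < ρ)
    (hx : x ∈ Set.Icc a b) : (x : ℂ) ∈ bernsteinEllipse a b ρ := by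
  simp only [bernsteinEllipse, Set.mem_ofPred_eq, dist_eq_norm, ← Complex.ofReal_sub,
    Complex.norm_real, Real.norm_eq_abs]
  rw [abs_of_nonneg (by linarith [hx.1]), abs_of_nonpos (by linarith [hx.2])]
  have hρ0 : 0 < ρ := by linarith
  have : 2 < ρ + ρ⁻¹ := by
    have h5 : ρ * ρ⁻¹ = 1 := mul_inv_cancel₀ hρ0.ne'
    have : ρ⁻¹ < 1 := inv_lt_one_of_one_lt₀ hρ
    nlinarith
  nlinarith

/-- **Bernstein's theorem** on polynomial approximation of functions that are holomorphic and
bounded on a Bernstein ellipse. -/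
theorem exists_polynomial_near_of_bernsteinEllipse {a b ρ B : ℝ} (hab : a < b) (hρ : 1 < ρ)
    (f : ℂ → ℂ) (hf : ∀ z ∈ bernsteinEllipse a b ρ, DifferentiableAt ℂ f z ∧ ‖f z‖ ≤ B)
    {ν : ℕ} (hν : 1 ≤ ν) :
    ∃ P : ℂ[X], P.natDegree ≤ ν - 1 ∧ ∀ x ∈ Set.Icc a b,
      ‖f (x : ℂ) - P.eval (x : ℂ)‖ ≤ 2 * B * ρ⁻¹ ^ ν / (1 - ρ⁻¹) := by
  have hρ0 : 0 < ρ := by linarith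
  have hρ1 : ρ⁻¹ < 1 := inv_lt_one_of_one_lt₀ hρ
  have hρ' : 0 < ρ⁻¹ := inv_pos.2 hρ0
  obtain ⟨c, hc, hsum⟩ := exists_hasSum_laurent_of_bounded (B := B) hρ
    (fun w => f ((a + b) / 2 + (b - a) / 4 * (w + w⁻¹))) (by
      intro w h1 h2
      have hw : w ≠ 0 := norm_pos_iff.1 (hρ'.trans h1)
      obtain ⟨h3, h4⟩ := hf _ (joukowski_mem_bernsteinEllipse hab h1 h2 hρ)
      refine ⟨?_, h4⟩
      refine h3.comp (f := fun w : ℂ => ((a + b) / 2 + (b - a) / 4 * (w + w⁻¹) : ℂ)) w ?_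
      fun_prop (disch := assumption))
  set A : ℂ[X] := C ((2 / (b - a) : ℝ) : ℂ) * (X - C (((a + b) / 2 : ℝ) : ℂ)) with hA
  have hAd : A.natDegree ≤ 1 :=
    (natDegree_C_mul_le _ _).trans (by rw [natDegree_X_sub_C])
  -- The truncated Chebyshev series. Folding n with -n counts the index 0 twice, hence the
  -- subtraction of c 0.
  refine ⟨(∑ n ∈ Finset.range ν, C (c n + c (-n)) * Chebyshev.T ℂ n - C (c 0)).comp A, ?_, ?_⟩
  · rw [natDegree_comp]
    have h1 : (∑ n ∈ Finset.range ν, C (c n + c (-n)) * Chebyshev.T ℂ n - C (c 0)).natDegree ≤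
        ν - 1 := by
      refine (natDegree_sub_le _ _).trans (max_le (natDegree_sum_le_of_forall_le _ _ fun n hn => ?_)
        ((natDegree_C _).trans_le (Nat.zero_le _)))
      refine (natDegree_C_mul_le _ _).trans ?_
      rw [Chebyshev.natDegree_T]
      simp only [Finset.mem_range] at hn
      omega
    nlinarith
  · intro x hx
    have h0 : 0 < b - a := by linarith
    set y := 2 / (b - a) * (x - (a + b) / 2) with hy
    have hy1 : -1 ≤ y := by
      rw [hy, div_mul_eq_mul_div, le_div_iff₀ h0]; linarith [hx.1]
    have hy2 : y ≤ 1 := by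
      rw [hy, div_mul_eq_mul_div, div_le_iff₀ h0]; linarith [hx.2]
    obtain ⟨θ, hθ⟩ : ∃ θ, y = Real.cos θ := ⟨Real.arccos y, (Real.cos_arccos hy1 hy2).symm⟩
    have hxθ : ∀ s : ℝ, Real.cos s = Real.cos θ → ((a + b) / 2 + (b - a) / 4 *
        (Complex.exp (s * Complex.I) + (Complex.exp (s * Complex.I))⁻¹) : ℂ) = x := by
      intro s hs
      have h1 : Complex.exp (s * Complex.I) + (Complex.exp (s * Complex.I))⁻¹ = 2 * (y : ℂ) := by
        rw [hθ, ← hs, Complex.ofReal_cos, Complex.two_cos, ← Complex.exp_neg, neg_mul]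
      have h2 : (a + b) / 2 + (b - a) / 4 * (2 * y) = x := by
        rw [hy]
        field_simp
        ring
      rw [h1, ← h2]
      push_cast
      ring
    have hs1 := hsum θ
    have hs2 := hsum (-θ)
    rw [hxθ θ rfl] at hs1
    rw [hxθ (-θ) (Real.cos_neg θ)] at hs2
    -- Both ±θ represent the same x; averaging their expansions leaves only cosines.
    have hs3 : HasSum (fun n : ℤ => c n * Complex.cos (n * θ)) (f x) := by
      have := (hs1.add hs2).div_const 2
      rw [add_self_div_two] at this
      refine this.congr_fun fun n => ?_
      rw [Complex.cos]
      push_cast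
      ring_nf
    have hs4 := hs3.nat_add_neg
    have hs5 : HasSum (fun n : ℕ => (c n + c (-n)) * (Chebyshev.T ℂ n).eval (y : ℂ))
        (f x + c 0) := by
      convert! hs4 using 1
      · funext n
        rw [hθ, Complex.ofReal_cos, Chebyshev.T_complex_cos]
        push_cast
        rw [neg_mul, Complex.cos_neg]
        ring
      · simp
    have hbd : ∀ n : ℕ, ‖(c n + c (-n)) * (Chebyshev.T ℂ n).eval (y : ℂ)‖ ≤ 2 * B * ρ⁻¹ ^ n := by
      intro n
      rw [norm_mul]
      have h1 : ‖(Chebyshev.T ℂ n).eval (y : ℂ)‖ ≤ 1 := by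
        rw [hθ, ← Chebyshev.complex_ofReal_eval_T, Chebyshev.T_real_cos, Complex.norm_real]
        exact Real.abs_cos_le_one _
      refine (mul_le_of_le_one_right (norm_nonneg _) h1).trans ?_
      refine (norm_add_le _ _).trans ?_
      linarith [(hc n).1, (hc n).2]
    have hfin := norm_sub_le_of_geometric_bound_of_hasSum hρ1 hbd hs5 ν
    have hAe : A.eval (x : ℂ) = (y : ℂ) := by
      simp only [hA, hy, eval_mul, eval_C, eval_sub, eval_X]
      push_cast
      rfl
    rw [eval_comp, hAe, eval_sub, eval_C, eval_finsetSum, norm_sub_rev]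
    simp only [eval_mul, eval_C]
    rwa [sub_sub, add_comm (c 0) (f x)]

/-! ### One-dimensional quadrature errors. -/

theorem QuadratureRule.HasOrder.sum_eval {a b : ℝ} (hab : a ≤ b) {Q : QuadratureRule a b} {ν : ℕ}
    (hQ : Q.HasOrder ν) {P : ℂ[X]} (hP : P.natDegree ≤ ν - 1) :
    ∑ j, (Q.weight j : ℂ) * P.eval (Q.node j : ℂ) = ∫ s in Set.Icc a b, P.eval (s : ℂ) := by
  have hν := hQ.1
  have hlt : P.natDegree < ν := by omega
  have hmon : ∀ k ∈ Finset.range ν, ∑ j, (Q.weight j : ℂ) * (Q.node j : ℂ) ^ k =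
      ∫ s in Set.Icc a b, (s : ℂ) ^ k := by
    intro k hk
    have h1 := hQ.2 (X ^ k) (by rw [natDegree_X_pow]; simp at hk; omega)
    simp only [QuadratureRule.apply, eval_pow, eval_X] at h1
    rw [intervalIntegral.integral_of_le hab, ← integral_Icc_eq_integral_Ioc] at h1
    have h2 := congrArg (fun x : ℝ => (x : ℂ)) h1
    simp only [← integral_complex_ofReal] at h2
    push_cast at h2
    exact h2
  simp only [eval_eq_sum_range' hlt, Finset.mul_sum]
  rw [Finset.sum_comm, integral_finsetSum]
  · refine Finset.sum_congr rfl fun k hk => ?_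
    rw [integral_const_mul, ← hmon k hk, Finset.mul_sum]
    exact Finset.sum_congr rfl fun j _ => by ring
  · intro k _
    exact (by fun_prop : Continuous fun s : ℝ => P.coeff k * (s : ℂ) ^ k).continuousOn
      |>.integrableOn_compact isCompact_Icc

theorem QuadratureRule.HasOrder.sum_weight {a b : ℝ} {Q : QuadratureRule a b} {ν : ℕ}
    (hQ : Q.HasOrder ν) : ∑ j, Q.weight j = b - a := by
  have := hQ.2 1 (by simp)
  simpa [QuadratureRule.apply] using this

/-- The error of a quadrature rule with positive weights is controlled by the error of
polynomial approximation. -/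
theorem QuadratureRule.HasOrder.norm_sum_sub_integral_le {a b : ℝ} (hab : a ≤ b)
    {Q : QuadratureRule a b} {ν : ℕ} (hQ : Q.HasOrder ν) (hw : Q.HasPosWeights) {P : ℂ[X]}
    (hP : P.natDegree ≤ ν - 1) {f : ℝ → ℂ} (hf : ContinuousOn f (Set.Icc a b)) {ε : ℝ}
    (hfP : ∀ x ∈ Set.Icc a b, ‖f x - P.eval (x : ℂ)‖ ≤ ε) :
    ‖∑ j, (Q.weight j : ℂ) * f (Q.node j) - ∫ s in Set.Icc a b, f s‖ ≤ 2 * (b - a) * ε := by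
  have hfi : IntegrableOn f (Set.Icc a b) := hf.integrableOn_compact isCompact_Icc
  have hPi : IntegrableOn (fun s : ℝ => P.eval (s : ℂ)) (Set.Icc a b) :=
    (by fun_prop : Continuous fun s : ℝ => P.eval (s : ℂ)).continuousOn.integrableOn_compact
      isCompact_Icc
  -- By exactness P can be subtracted from f in both the sum and the integral; each then contributes
  -- at most (b - a) ε.
  have h1 : ∑ j, (Q.weight j : ℂ) * f (Q.node j) - ∫ s in Set.Icc a b, f s =
      ∑ j, (Q.weight j : ℂ) * (f (Q.node j) - P.eval (Q.node j : ℂ)) -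
        ∫ s in Set.Icc a b, (f s - P.eval (s : ℂ)) := by
    rw [integral_sub hfi hPi, ← hQ.sum_eval hab hP]
    simp only [mul_sub, Finset.sum_sub_distrib]
    ring
  rw [h1]
  refine (norm_sub_le _ _).trans ?_
  have h2 : ‖∑ j, (Q.weight j : ℂ) * (f (Q.node j) - P.eval (Q.node j : ℂ))‖ ≤ (b - a) * ε := by
    refine (norm_sum_le _ _).trans ?_
    rw [← hQ.sum_weight, Finset.sum_mul]
    refine Finset.sum_le_sum fun j _ => ?_
    rw [norm_mul, Complex.norm_real, Real.norm_of_nonneg (hw j).le]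
    exact mul_le_mul_of_nonneg_left (hfP _ (Q.node_mem j)) (hw j).le
  have h3 : ‖∫ s in Set.Icc a b, (f s - P.eval (s : ℂ))‖ ≤ ε * (b - a) := by
    have := norm_setIntegral_le_of_norm_le_const (μ := volume) (s := Set.Icc a b)
      isCompact_Icc.measure_lt_top hfP
    rwa [Real.volume_real_Icc_of_le hab] at this
  linarith

/-! ### The Fredholm series and its Nyström counterpart. -/

theorem continuousOn_kernelMinor {N : ℕ} {a b : Fin N → ℝ} {K : Fin N → Fin N → ℝ → ℝ → ℂ}
    (hK : ∀ i j, ContinuousOn (Function.uncurry (K i j))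
      (Set.Icc (a i) (b i) ×ˢ Set.Icc (a j) (b j))) {n : ℕ} (i : Fin n → Fin N) :
    ContinuousOn (kernelMinor K i) (intervalBox a b i) := by
  unfold kernelMinor
  simp only [Matrix.det_apply]
  refine continuousOn_finsetSum _ fun σ _ => ContinuousOn.const_smul ?_ _
  refine continuousOn_finsetProd _ fun p _ => ?_
  exact (hK (i (σ p)) (i p)).comp (f := fun t : Fin n → ℝ => (t (σ p), t p)) (by fun_prop)
    fun t ht => ⟨ht (σ p) trivial, ht p trivial⟩

theorem exists_kernel_bound {N : ℕ} {a b : Fin N → ℝ} {K : Fin N → Fin N → ℝ → ℝ → ℂ}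
    (hK : ∀ i j, ContinuousOn (Function.uncurry (K i j))
      (Set.Icc (a i) (b i) ×ˢ Set.Icc (a j) (b j))) :
    ∃ B : ℝ, 1 ≤ B ∧ ∀ i j, ∀ x ∈ Set.Icc (a i) (b i), ∀ y ∈ Set.Icc (a j) (b j),
      ‖K i j x y‖ ≤ B := by
  have h : ∀ i j, ∃ B : ℝ, ∀ q ∈ Set.Icc (a i) (b i) ×ˢ Set.Icc (a j) (b j),
      ‖Function.uncurry (K i j) q‖ ≤ B := fun i j =>
    (isCompact_Icc.prod isCompact_Icc).exists_bound_of_continuousOn (hK i j)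
  choose B hB using h
  obtain ⟨C, hC⟩ := Finite.exists_le fun q : Fin N × Fin N => B q.1 q.2
  exact ⟨max C 1, le_max_right _ _, fun i j x hx y hy =>
    (hB i j (x, y) ⟨hx, hy⟩).trans ((hC (i, j)).trans (le_max_left _ _))⟩

theorem norm_kernelMinor_le {N : ℕ} {a b : Fin N → ℝ} {K : Fin N → Fin N → ℝ → ℝ → ℂ} {B : ℝ}
    (hB : ∀ i j, ∀ x ∈ Set.Icc (a i) (b i), ∀ y ∈ Set.Icc (a j) (b j), ‖K i j x y‖ ≤ B)
    {n : ℕ} (i : Fin n → Fin N) {t : Fin n → ℝ} (ht : t ∈ intervalBox a b i) :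
    ‖kernelMinor K i t‖ ≤ √((n : ℝ) ^ n) * B ^ n :=
  norm_det_le_of_norm_le _ fun p q => hB _ _ _ (ht p trivial) _ (ht q trivial)

theorem exists_length_bound {N : ℕ} (a b : Fin N → ℝ) : ∃ L : ℝ, 1 ≤ L ∧ ∀ i, b i - a i ≤ L := by
  obtain ⟨C, hC⟩ := Finite.exists_le fun i => b i - a i
  exact ⟨max C 1, le_max_right _ _, fun i => (hC i).trans (le_max_left _ _)⟩

/-- Hadamard's inequality, box volumes at most L^n and N^n multi-indices give the bound. The factor
n + 1 is slack, so that the same majorant also serves the quadrature error. -/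
theorem norm_fredholmTerm_le {N : ℕ} {a b : Fin N → ℝ} (hab : ∀ i, a i < b i)
    {K : Fin N → Fin N → ℝ → ℝ → ℂ} {B L R : ℝ} (hB1 : 1 ≤ B)
    (hB : ∀ i j, ∀ x ∈ Set.Icc (a i) (b i), ∀ y ∈ Set.Icc (a j) (b j), ‖K i j x y‖ ≤ B)
    (hL : ∀ i, b i - a i ≤ L) (hL1 : 1 ≤ L) {z : ℂ} (hz : ‖z‖ ≤ R) (n : ℕ) :
    ‖fredholmTerm a b K z n‖ ≤
      ((n : ℝ) + 1) * (R * N * L * B) ^ n * √((n : ℝ) ^ n) / n.factorial := by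
  have hR : 0 ≤ R := (norm_nonneg z).trans hz
  have hI : ∀ i : Fin n → Fin N, ‖∫ t in intervalBox a b i, kernelMinor K i t‖ ≤
      √((n : ℝ) ^ n) * B ^ n * L ^ n := by
    intro i
    refine (norm_setIntegral_le_of_norm_le_const (isCompact_pi_Icc _ _).measure_lt_top
      fun t ht => norm_kernelMinor_le hB i ht).trans ?_
    exact mul_le_mul_of_nonneg_left
      (volume_real_pi_Icc_le (fun p => (hab _).le) fun p => hL _) (by positivity)
  unfold fredholmTerm
  rw [norm_mul, norm_div, norm_pow, Complex.norm_natCast]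
  have hS : ‖∑ i : Fin n → Fin N, ∫ t in intervalBox a b i, kernelMinor K i t‖ ≤
      (N : ℝ) ^ n * (√((n : ℝ) ^ n) * B ^ n * L ^ n) := by
    refine (norm_sum_le _ _).trans ((Finset.sum_le_sum fun i _ => hI i).trans (le_of_eq ?_))
    simp
  calc ‖z‖ ^ n / n.factorial * ‖∑ i : Fin n → Fin N, ∫ t in intervalBox a b i, kernelMinor K i t‖
      ≤ R ^ n / n.factorial * ((N : ℝ) ^ n * (√((n : ℝ) ^ n) * B ^ n * L ^ n)) := by gcongr
    _ = 1 * (R * N * L * B) ^ n * √((n : ℝ) ^ n) / n.factorial := by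
        simp only [mul_pow]
        ring
    _ ≤ _ := by
        gcongr
        linarith [(Nat.cast_nonneg n : (0 : ℝ) ≤ n)]

theorem fredholmTerm_summable_and_differentiable {N : ℕ} {a b : Fin N → ℝ} (hab : ∀ i, a i < b i)
    {K : Fin N → Fin N → ℝ → ℝ → ℂ}
    (hK : ∀ i j, ContinuousOn (Function.uncurry (K i j))
      (Set.Icc (a i) (b i) ×ˢ Set.Icc (a j) (b j))) :
    (∀ z : ℂ, Summable (fredholmTerm a b K z)) ∧ Differentiable ℂ (fredholmDet a b K) := by
  obtain ⟨B, hB1, hB⟩ := exists_kernel_bound hK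
  obtain ⟨L, hL1, hL⟩ := exists_length_bound a b
  have hsum : ∀ R : ℝ, 0 ≤ R → Summable fun n : ℕ =>
      ((n : ℝ) + 1) * (R * N * L * B) ^ n * √((n : ℝ) ^ n) / n.factorial := fun R hR =>
    summable_hadamard _ (by positivity)
  refine ⟨fun z => Summable.of_norm_bounded (hsum ‖z‖ (norm_nonneg z)) fun n =>
    norm_fredholmTerm_le hab hB1 hB hL hL1 le_rfl n, fun z => ?_⟩
  have hR : 0 ≤ ‖z‖ + 1 := by positivity
  have := Complex.differentiableOn_tsum_of_summable_norm (hsum _ hR)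
    (F := fun n z => fredholmTerm a b K z n) (U := Metric.ball 0 (‖z‖ + 1))
    (fun n => by unfold fredholmTerm; fun_prop) Metric.isOpen_ball
    (fun n w hw => norm_fredholmTerm_le hab hB1 hB hL hL1 (mem_ball_zero_iff.1 hw).le n)
  exact (this z (by simp)).differentiableAt (Metric.isOpen_ball.mem_nhds (by simp))

/-- In von Koch's formula an n-tuple of matrix indices splits into a tuple of interval labels and a
tuple of nodes. Each weight root leaves the determinant once from a row and once from a column. -/
theorem hasSum_nystromDet {N : ℕ} {a b : Fin N → ℝ} (K : Fin N → Fin N → ℝ → ℝ → ℂ)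
    {Q : ∀ i, QuadratureRule (a i) (b i)} (hw : ∀ i, (Q i).HasPosWeights) (z : ℂ) :
    HasSum (fun n : ℕ => z ^ n / (n.factorial : ℂ) * ∑ i : Fin n → Fin N,
      ∑ j : (∀ p, Fin (Q (i p)).size), ((∏ p, (Q (i p)).weight (j p) : ℝ) : ℂ) *
        kernelMinor K i fun p => (Q (i p)).node (j p)) (nystromDet K Q z) := by
  refine (hasSum_det_one_add_smul (nystromMatrix K Q) z).congr_fun fun n => ?_
  congr 1
  let e : (Σ i : Fin n → Fin N, ∀ p, Fin (Q (i p)).size) ≃ (Fin n → Σ i, Fin (Q i).size) :=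
    { toFun := fun g p => ⟨g.1 p, g.2 p⟩
      invFun := fun f => ⟨fun p => (f p).1, fun p => (f p).2⟩
      left_inv := fun _ => rfl
      right_inv := fun _ => rfl }
  rw [← e.sum_comp, Fintype.sum_sigma]
  refine Finset.sum_congr rfl fun i _ => Finset.sum_congr rfl fun j _ => ?_
  set v : Fin n → ℂ := fun p => (√((Q (i p)).weight (j p)) : ℂ) with hv
  have h1 : (nystromMatrix K Q).submatrix (e ⟨i, j⟩) (e ⟨i, j⟩) =
      Matrix.of fun p q => v p * (Matrix.of fun p q => v q *
        (Matrix.of fun p q =>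
          K (i p) (i q) ((Q (i p)).node (j p)) ((Q (i q)).node (j q))) p q) p q := by
    ext p q
    simp only [nystromMatrix, Matrix.submatrix_apply, Matrix.of_apply, e, Equiv.coe_fn_mk, hv]
    ring
  rw [h1, Matrix.det_mul_column, Matrix.det_mul_row, ← mul_assoc, ← Finset.prod_mul_distrib]
  simp only [hv, ← Complex.ofReal_mul, Real.mul_self_sqrt (hw _ _).le]
  rw [← Complex.ofReal_prod]
  rfl

/-- If the quadrature errors of all minors in all coordinates are small, then the Nyström
approximation is close to the Fredholm determinant. -/
theorem norm_nystromDet_sub_fredholmDet_le {N : ℕ} {a b : Fin N → ℝ} (hab : ∀ i, a i < b i)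
    {K : Fin N → Fin N → ℝ → ℝ → ℂ}
    (hK : ∀ i j, ContinuousOn (Function.uncurry (K i j))
      (Set.Icc (a i) (b i) ×ˢ Set.Icc (a j) (b j)))
    {L B η R : ℝ} (hL1 : 1 ≤ L) (hL : ∀ i, b i - a i ≤ L) (hB : 0 ≤ B) (hη : 0 ≤ η)
    {Q : ∀ i, QuadratureRule (a i) (b i)} {ν : ℕ} (hQ : ∀ i, (Q i).HasOrder ν)
    (hw : ∀ i, (Q i).HasPosWeights)
    (herr : ∀ (n : ℕ) (i : Fin n → Fin N) (p : Fin n), ∀ t ∈ intervalBox a b i,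
      ‖∑ j, ((Q (i p)).weight j : ℂ) * kernelMinor K i (Function.update t p ((Q (i p)).node j)) -
        ∫ s in Set.Icc (a (i p)) (b (i p)), kernelMinor K i (Function.update t p s)‖ ≤
        η * (√((n : ℝ) ^ n) * B ^ n))
    {z : ℂ} (hz : ‖z‖ ≤ R) :
    ‖nystromDet K Q z - fredholmDet a b K z‖ ≤
      η * ∑' n : ℕ, ((n : ℝ) + 1) * (R * N * L * B) ^ n * √((n : ℝ) ^ n) / n.factorial := by
  have hR : 0 ≤ R := (norm_nonneg z).trans hz
  have hd := (hasSum_nystromDet K hw z).sub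
    ((fredholmTerm_summable_and_differentiable hab hK).1 z).hasSum
  refine hd.norm_le_of_bounded
    ((summable_hadamard (R * N * L * B) (by positivity)).hasSum.mul_left η) fun n => ?_
  have hdiff : ∀ i : Fin n → Fin N,
      ‖∑ j : (∀ p, Fin (Q (i p)).size), ((∏ p, (Q (i p)).weight (j p) : ℝ) : ℂ) *
        kernelMinor K i (fun p => (Q (i p)).node (j p)) -
        ∫ t in intervalBox a b i, kernelMinor K i t‖ ≤
      n * L ^ n * (η * (√((n : ℝ) ^ n) * B ^ n)) := fun i =>
    norm_product_quadrature_sub_integral_le hL1 (by positivity) (fun p => a (i p))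
      (fun p => b (i p)) (fun p => (hab _).le) (fun p => hL _) (fun p => (Q (i p)).size)
      (fun p => (Q (i p)).weight) (fun p => (Q (i p)).node) (fun p j => (hw _ j).le)
      (fun p => by rw [(hQ (i p)).sum_weight]; exact hL _)
      (fun p j => (Q (i p)).node_mem j) (kernelMinor K i) (continuousOn_kernelMinor hK i)
      (herr n i)
  unfold fredholmTerm
  rw [← mul_sub, ← Finset.sum_sub_distrib, norm_mul, norm_div, norm_pow, Complex.norm_natCast]
  have hS := (norm_sum_le Finset.univ _).trans (Finset.sum_le_sum fun i _ => hdiff i)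
  rw [Finset.sum_const, Finset.card_univ, Fintype.card_fun, Fintype.card_fin, Fintype.card_fin,
    nsmul_eq_mul, Nat.cast_pow] at hS
  refine (mul_le_mul (div_le_div_of_nonneg_right (pow_le_pow_left₀ (norm_nonneg z) hz n)
    (by positivity)) hS (norm_nonneg _) (by positivity)).trans ?_
  calc R ^ n / n.factorial * ((N : ℝ) ^ n * (n * L ^ n * (η * (√((n : ℝ) ^ n) * B ^ n))))
      = η * (n * (R * N * L * B) ^ n * √((n : ℝ) ^ n) / n.factorial) := by
        simp only [mul_pow]
        ring
    _ ≤ _ := by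
        gcongr
        linarith

/-! ### Minors of `C^{m,1}` kernels. -/

/-- Perturbation of the determinant in one row and one column. -/
theorem norm_det_sub_det_le {n : ℕ} {M P : Matrix (Fin n) (Fin n) ℂ} (p : Fin n) {B ε : ℝ}
    (hε : 0 < ε) (hB : 1 ≤ B) (hM : ∀ i j, ‖M i j‖ ≤ B) (hP : ∀ i j, ‖P i j‖ ≤ B)
    (hMP : ∀ i j, ‖M i j - P i j‖ ≤ ε) (heq : ∀ i j, i ≠ p → j ≠ p → M i j = P i j) :
    ‖M.det - P.det‖ ≤ 2 * (ε * (√((n : ℝ) ^ n) * B ^ n)) := by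
  -- This hybrid differs from M only in row p and from P only in column p, whence the factor 2.
  set H := M.updateRow p (P p) with hH
  have hεB : ε ≤ ε * B := le_mul_of_one_le_right hε.le hB
  have hHB : ∀ i j, ‖H i j‖ ≤ B := by
    intro i j
    rw [hH, Matrix.updateRow_apply]
    split_ifs
    · exact hP p j
    · exact hM i j
  have h1 : M.det - H.det = (M.updateRow p (M p - P p)).det := by
    have := Matrix.det_updateRow_add M p (M p - P p) (P p)
    rw [sub_add_cancel, Matrix.updateRow_eq_self] at this
    rw [this, hH, add_sub_cancel_right]
  have h2 : H.det - P.det = (P.updateCol p fun i => H i p - P i p).det := by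
    have := Matrix.det_updateCol_add P p (fun i => H i p - P i p) (fun i => P i p)
    have e1 : P.updateCol p (fun i => P i p) = P := Matrix.updateCol_eq_self P p
    have e2 : P.updateCol p ((fun i => H i p - P i p) + fun i => P i p) = H := by
      ext i j
      rw [Matrix.updateCol_apply]
      split_ifs with hj
      · subst hj; simp
      · rw [hH, Matrix.updateRow_apply]
        split_ifs with hi
        · rw [hi]
        · exact (heq i j hi hj).symm
    rw [e1, e2] at this
    rw [this, add_sub_cancel_right]
  have h3 : ‖M.det - H.det‖ ≤ ε * (√((n : ℝ) ^ n) * B ^ n) := by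
    rw [h1]
    refine norm_det_le_of_row_le _ p hε (fun j => ?_) fun i j hi => ?_
    · rw [Matrix.updateRow_self]
      exact (hMP p j).trans hεB
    · rw [Matrix.updateRow_ne hi]
      exact hM i j
  have h4 : ‖H.det - P.det‖ ≤ ε * (√((n : ℝ) ^ n) * B ^ n) := by
    rw [h2]
    refine norm_det_le_of_col_le _ p hε (fun i => ?_) fun i j hj => ?_
    · rw [Matrix.updateCol_self, hH, Matrix.updateRow_apply]
      split_ifs with hi
      · rw [hi, sub_self, norm_zero]
        positivity
      · exact (hMP i p).trans hεB
    · rw [Matrix.updateCol_ne hj]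
      exact hP i j
  have h5 := norm_sub_le_norm_sub_add_norm_sub M.det H.det P.det
  linarith

/-- Each product in the Leibniz expansion meets row p once and column p once, so the degrees add up
to at most 2h. -/
theorem natDegree_det_le_two_mul {n : ℕ} (P : Matrix (Fin n) (Fin n) ℂ[X]) (p : Fin n) (h : ℕ)
    (hP : ∀ i j, (P i j).natDegree ≤ (if i = p then h else 0) + (if j = p then h else 0)) :
    P.det.natDegree ≤ 2 * h := by
  rw [Matrix.det_apply]
  refine natDegree_sum_le_of_forall_le _ _ fun σ _ => ?_
  refine (natDegree_smul_le _ _).trans ((natDegree_prod_le _ _).trans ?_)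
  refine (Finset.sum_le_sum fun i _ => hP (σ i) i).trans (le_of_eq ?_)
  rw [Finset.sum_add_distrib, Equiv.sum_comp σ fun i => if i = p then h else 0]
  simp
  ring

/-- Uniform approximability of the kernels by polynomials of degree at most `h`, in the first
variable, in the second variable and on the diagonal. -/
def KernelApprox {N : ℕ} (a b : Fin N → ℝ) (K : Fin N → Fin N → ℝ → ℝ → ℂ) (h : ℕ) (ε : ℝ) :
    Prop :=
  (∀ i j, ∀ y ∈ Set.Icc (a j) (b j), ∃ P : ℂ[X], P.natDegree ≤ h ∧
      ∀ x ∈ Set.Icc (a i) (b i), ‖K i j x y - P.eval (x : ℂ)‖ ≤ ε) ∧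
    (∀ i j, ∀ x ∈ Set.Icc (a i) (b i), ∃ P : ℂ[X], P.natDegree ≤ h ∧
      ∀ y ∈ Set.Icc (a j) (b j), ‖K i j x y - P.eval (y : ℂ)‖ ≤ ε) ∧
    ∀ i, ∃ P : ℂ[X], P.natDegree ≤ h ∧
      ∀ x ∈ Set.Icc (a i) (b i), ‖K i i x x - P.eval (x : ℂ)‖ ≤ ε

theorem KernelApprox.exists_polynomial_kernelMinor {N : ℕ} {a b : Fin N → ℝ}
    {K : Fin N → Fin N → ℝ → ℝ → ℂ} {h : ℕ} {ε B : ℝ} (hA : KernelApprox a b K h ε)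
    (hε : 0 < ε) (hB1 : 1 ≤ B)
    (hB : ∀ i j, ∀ x ∈ Set.Icc (a i) (b i), ∀ y ∈ Set.Icc (a j) (b j), ‖K i j x y‖ ≤ B)
    {n : ℕ} (i : Fin n → Fin N) (p : Fin n) {t : Fin n → ℝ} (ht : t ∈ intervalBox a b i) :
    ∃ P : ℂ[X], P.natDegree ≤ 2 * h ∧ ∀ s ∈ Set.Icc (a (i p)) (b (i p)),
      ‖kernelMinor K i (Function.update t p s) - P.eval (s : ℂ)‖ ≤
        2 * (ε * (√((n : ℝ) ^ n) * (B + ε) ^ n)) := by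
  have hent : ∀ r q : Fin n, ∃ P : ℂ[X],
      P.natDegree ≤ (if r = p then h else 0) + (if q = p then h else 0) ∧
      ∀ s ∈ Set.Icc (a (i p)) (b (i p)),
        ‖K (i r) (i q) (Function.update t p s r) (Function.update t p s q) - P.eval (s : ℂ)‖ ≤ ε ∧
        (r ≠ p → q ≠ p →
          K (i r) (i q) (Function.update t p s r) (Function.update t p s q) = P.eval (s : ℂ)) := by
    intro r q
    by_cases hr : r = p
    · by_cases hq : q = p
      · subst hr hq
        obtain ⟨P, hP, hPe⟩ := hA.2.2 (i q)
        exact ⟨P, hP.trans (by simp), fun s hs =>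
          ⟨by simpa using hPe s hs, fun h => absurd rfl h⟩⟩
      · subst hr
        obtain ⟨P, hP, hPe⟩ := hA.1 (i r) (i q) (t q) (ht q trivial)
        exact ⟨P, hP.trans (by simp), fun s hs =>
          ⟨by simpa [hq] using hPe s hs, fun h => absurd rfl h⟩⟩
    · by_cases hq : q = p
      · subst hq
        obtain ⟨P, hP, hPe⟩ := hA.2.1 (i r) (i q) (t r) (ht r trivial)
        exact ⟨P, hP.trans (by simp), fun s hs =>
          ⟨by simpa [hr] using hPe s hs, fun _ h => absurd rfl h⟩⟩
      · exact ⟨C (K (i r) (i q) (t r) (t q)), by simp, fun s _ => by simp [hr, hq, hε.le]⟩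
  choose P hPd hPe using hent
  refine ⟨(Matrix.of P).det, natDegree_det_le_two_mul _ p h fun r q => hPd r q, fun s hs => ?_⟩
  have hu : Function.update t p s ∈ intervalBox a b i :=
    update_mem_pi_Icc (a := fun p => a (i p)) (b := fun p => b (i p)) ht p hs
  have hev : (Matrix.of P).det.eval (s : ℂ) =
      (Matrix.of fun r q => (P r q).eval (s : ℂ)).det := by
    rw [← coe_evalRingHom, RingHom.map_det]
    rfl
  have hKB : ∀ r q,
      ‖K (i r) (i q) (Function.update t p s r) (Function.update t p s q)‖ ≤ B := fun r q =>
    hB _ _ _ (hu r trivial) _ (hu q trivial)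
  rw [hev, kernelMinor]
  refine norm_det_sub_det_le p hε (by linarith) (fun r q => (hKB r q).trans (by linarith))
    (fun r q => ?_) (fun r q => (hPe r q s hs).1) fun r q hr hq => (hPe r q s hs).2 hr hq
  have h1 := norm_sub_norm_le ((P r q).eval (s : ℂ))
    (K (i r) (i q) (Function.update t p s r) (Function.update t p s q))
  rw [norm_sub_rev] at h1
  have h2 := (hPe r q s hs).1
  have h3 := hKB r q
  simp only [Matrix.of_apply]
  linarith

theorem continuousOn_kernelMinor_update {N : ℕ} {a b : Fin N → ℝ}
    {K : Fin N → Fin N → ℝ → ℝ → ℂ}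
    (hK : ∀ i j, ContinuousOn (Function.uncurry (K i j))
      (Set.Icc (a i) (b i) ×ˢ Set.Icc (a j) (b j))) {n : ℕ} (i : Fin n → Fin N) (p : Fin n)
    {t : Fin n → ℝ} (ht : t ∈ intervalBox a b i) :
    ContinuousOn (fun s => kernelMinor K i (Function.update t p s))
      (Set.Icc (a (i p)) (b (i p))) :=
  (continuousOn_kernelMinor hK i).comp (by fun_prop) fun _ hs =>
    update_mem_pi_Icc (a := fun p => a (i p)) (b := fun p => b (i p)) ht p hs

theorem exists_kernelApprox_of_isCLip {N : ℕ} {a b : Fin N → ℝ} (hab : ∀ i, a i < b i)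
    {K : Fin N → Fin N → ℝ → ℝ → ℂ} {m : ℕ}
    (hK : ∀ i j, IsCLip m (Function.uncurry (K i j))
      (Set.Icc (a i) (b i) ×ˢ Set.Icc (a j) (b j))) :
    ∃ c : ℝ, 0 < c ∧ ∀ h : ℕ, KernelApprox a b K h (c / ((h : ℝ) + 1) ^ (m + 1)) := by
  have h1 := fun i j => (hK i j).exists_hasLipDerivs (isCompact_Icc.prod isCompact_Icc)
    ((uniqueDiffOn_Icc (hab i)).prod (uniqueDiffOn_Icc (hab j)))
  choose M hM0 hM using h1
  have h2 := fun i => HasLipDerivs.exists_polynomial_near (hab i) m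
  choose c hc0 hc using h2
  obtain ⟨C₁, hC₁⟩ := Finite.exists_le fun q : Fin N × Fin N × Fin N => c q.1 * M q.2.1 q.2.2
  refine ⟨max C₁ 1, by positivity, fun h => ?_⟩
  have hle : ∀ l i j, c l * M i j / ((h : ℝ) + 1) ^ (m + 1) ≤
      max C₁ 1 / ((h : ℝ) + 1) ^ (m + 1) := by
    intro l i j
    gcongr
    exact (hC₁ (l, i, j)).trans (le_max_left _ _)
  refine ⟨fun i j y hy => ?_, fun i j x hx => ?_, fun i => ?_⟩
  · obtain ⟨P, hP, hPe⟩ := hc i (M i j) (hM0 i j) _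
      (hM i j (0, y) (1, 0) (a i) (b i) (by simp [Prod.norm_def])
        (fun t ht => ⟨by simpa using ht, by simpa using hy⟩)) h
    exact ⟨P, hP, fun x hx => (by simpa using hPe x hx : _ ≤ _).trans (hle _ _ _)⟩
  · obtain ⟨P, hP, hPe⟩ := hc j (M i j) (hM0 i j) _
      (hM i j (x, 0) (0, 1) (a j) (b j) (by simp [Prod.norm_def])
        (fun t ht => ⟨by simpa using hx, by simpa using ht⟩)) h
    exact ⟨P, hP, fun y hy => (by simpa using hPe y hy : _ ≤ _).trans (hle _ _ _)⟩
  -- The diagonal direction (1, 1) also has norm 1, as the product carries the supremum norm.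
  · obtain ⟨P, hP, hPe⟩ := hc i (M i i) (hM0 i i) _
      (hM i i (0, 0) (1, 1) (a i) (b i) (by simp [Prod.norm_def])
        (fun t ht => ⟨by simpa using ht, by simpa using ht⟩)) h
    exact ⟨P, hP, fun x hx => (by simpa using hPe x hx : _ ≤ _).trans (hle _ _ _)⟩

theorem exists_nystromDet_error_of_isCLip {N : ℕ} {a b : Fin N → ℝ} (hab : ∀ i, a i < b i)
    {K : Fin N → Fin N → ℝ → ℝ → ℂ}
    (hK : ∀ i j, ContinuousOn (Function.uncurry (K i j))
      (Set.Icc (a i) (b i) ×ˢ Set.Icc (a j) (b j))) {m : ℕ}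
    (hKm : ∀ i j, IsCLip m (Function.uncurry (K i j))
      (Set.Icc (a i) (b i) ×ˢ Set.Icc (a j) (b j))) (R : ℝ) :
    ∃ C : ℝ, ∀ ν : ℕ, ∀ Q : (∀ i, QuadratureRule (a i) (b i)), 1 ≤ ν →
      (∀ i, (Q i).HasOrder ν) → (∀ i, (Q i).HasPosWeights) → ∀ z : ℂ, ‖z‖ ≤ R →
        ‖nystromDet K Q z - fredholmDet a b K z‖ ≤ C * ((ν : ℝ) ^ (m + 1))⁻¹ := by
  obtain ⟨B, hB1, hB⟩ := exists_kernel_bound hK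
  obtain ⟨L, hL1, hL⟩ := exists_length_bound a b
  obtain ⟨c, hc0, hc⟩ := exists_kernelApprox_of_isCLip hab hKm
  set T := ∑' n : ℕ, ((n : ℝ) + 1) * (R * N * L * (B + c)) ^ n * √((n : ℝ) ^ n) / n.factorial
  -- One factor 2 comes from the quadrature error and one from the row and column perturbation;
  -- 2^(m+1) comes from ν ≤ 2(h + 1). The bound B + c in T works for every ν because ε ≤ c.
  refine ⟨4 * L * c * 2 ^ (m + 1) * T, fun ν Q hν hQ hw z hz => ?_⟩
  have hR : 0 ≤ R := (norm_nonneg z).trans hz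
  have hT : 0 ≤ T := tsum_nonneg fun n => by positivity
  -- The largest h with 2h ≤ ν - 1, so that the rule is exact on the approximating determinant.
  set h := (ν - 1) / 2 with hh
  set ε := c / ((h : ℝ) + 1) ^ (m + 1) with hε
  have hε0 : 0 < ε := by positivity
  have hεc : ε ≤ c := div_le_self hc0.le (one_le_pow₀ (by
    linarith [(Nat.cast_nonneg h : (0 : ℝ) ≤ h)]))
  have hmain := norm_nystromDet_sub_fredholmDet_le hab hK (L := L) (B := B + c) (η := 4 * L * ε)
    hL1 hL (by positivity) (by positivity) hQ hw (fun n i p t ht => by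
      obtain ⟨P, hP, hPe⟩ := (hc h).exists_polynomial_kernelMinor hε0 hB1 hB i p ht
      refine ((hQ (i p)).norm_sum_sub_integral_le (hab _).le (hw _) (hP.trans (by omega))
        (continuousOn_kernelMinor_update hK i p ht) hPe).trans ?_
      calc 2 * (b (i p) - a (i p)) * (2 * (ε * (√((n : ℝ) ^ n) * (B + ε) ^ n)))
          ≤ 2 * L * (2 * (ε * (√((n : ℝ) ^ n) * (B + c) ^ n))) := by
            gcongr
            exact hL _
        _ = _ := by ring) hz
  refine hmain.trans ?_
  have hν0 : (0 : ℝ) < ν := by exact_mod_cast hν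
  have hνh : (ν : ℝ) ≤ 2 * ((h : ℝ) + 1) := by
    have : ν ≤ 2 * (h + 1) := by omega
    exact_mod_cast this
  have hεν : ε ≤ c * 2 ^ (m + 1) * ((ν : ℝ) ^ (m + 1))⁻¹ := by
    rw [hε, ← div_eq_mul_inv, div_le_div_iff₀ (by positivity) (by positivity), mul_assoc, ← mul_pow]
    gcongr
  calc 4 * L * ε * T ≤ 4 * L * (c * 2 ^ (m + 1) * ((ν : ℝ) ^ (m + 1))⁻¹) * T := by gcongr
    _ = _ := by ring

/-! ### Minors of analytic kernels. -/

theorem exists_nystromDet_error_of_isBoundedAnalyticKernel {N : ℕ} {a b : Fin N → ℝ}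
    (hab : ∀ i, a i < b i) {K : Fin N → Fin N → ℝ → ℝ → ℂ}
    (hK : ∀ i j, ContinuousOn (Function.uncurry (K i j))
      (Set.Icc (a i) (b i) ×ˢ Set.Icc (a j) (b j))) {ρ : ℝ} (hρ : 1 < ρ)
    (hKρ : ∀ i j, IsBoundedAnalyticKernel (a i) (b i) (a j) (b j) ρ (K i j)) (R : ℝ) :
    ∃ C : ℝ, ∀ ν : ℕ, ∀ Q : (∀ i, QuadratureRule (a i) (b i)), 1 ≤ ν →
      (∀ i, (Q i).HasOrder ν) → (∀ i, (Q i).HasPosWeights) → ∀ z : ℂ, ‖z‖ ≤ R →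
        ‖nystromDet K Q z - fredholmDet a b K z‖ ≤ C * (ρ ^ ν)⁻¹ := by
  choose F hFan hFbd hFK using hKρ
  choose B₀ hB₀ using hFbd
  obtain ⟨B₁, hB₁⟩ := Finite.exists_le fun q : Fin N × Fin N => B₀ q.1 q.2
  set B := max B₁ 0
  have hB0 : 0 ≤ B := le_max_right _ _
  have hFB : ∀ i j, ∀ q ∈ bernsteinEllipse (a i) (b i) ρ ×ˢ bernsteinEllipse (a j) (b j) ρ,
      ‖F i j q‖ ≤ B := fun i j q hq =>
    (hB₀ i j q hq).trans ((hB₁ (i, j)).trans (le_max_left _ _))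
  obtain ⟨L, hL1, hL⟩ := exists_length_bound a b
  have hρ0 : 0 < ρ := by linarith
  have hρ1 : 0 < 1 - ρ⁻¹ := sub_pos.2 (inv_lt_one_of_one_lt₀ hρ)
  set T := ∑' n : ℕ, ((n : ℝ) + 1) * (R * N * L * B) ^ n * √((n : ℝ) ^ n) / n.factorial
  refine ⟨4 * L / (1 - ρ⁻¹) * T, fun ν Q hν hQ hw z hz => ?_⟩
  have hmain := norm_nystromDet_sub_fredholmDet_le hab hK (L := L) (B := B)
    (η := 4 * L * ρ⁻¹ ^ ν / (1 - ρ⁻¹)) hL1 hL hB0 (by positivity) hQ hw (fun n i p t ht => by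
      -- Only coordinate p becomes complex. The others stay real in their intervals, which lie
      -- inside the ellipses, so the minor extends to the ellipse of coordinate p.
      set u : ℂ → Fin n → ℂ := fun s => Function.update (fun q => (t q : ℂ)) p s with hu
      have hut : ∀ s q, u s q ∈ bernsteinEllipse (a (i q)) (b (i q)) ρ ∨ q = p := by
        intro s q
        by_cases hq : q = p
        · exact Or.inr hq
        · left
          simpa [hu, hq] using ofReal_mem_bernsteinEllipse (hab (i q)) hρ (ht q trivial)
      have hus : ∀ s ∈ bernsteinEllipse (a (i p)) (b (i p)) ρ, ∀ q,
          u s q ∈ bernsteinEllipse (a (i q)) (b (i q)) ρ := by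
        intro s hs q
        rcases hut s q with h | rfl
        · exact h
        · simpa [hu] using hs
      set f : ℂ → ℂ := fun s => (Matrix.of fun r q => F (i r) (i q) (u s r, u s q)).det with hf
      have hud : ∀ q s, DifferentiableAt ℂ (fun s => u s q) s := by
        intro q s
        by_cases hq : q = p
        · subst hq
          simp [hu]
        · simp [hu, hq]
      obtain ⟨P, hP, hPe⟩ := exists_polynomial_near_of_bernsteinEllipse
        (B := √((n : ℝ) ^ n) * B ^ n) (hab (i p)) hρ f (fun s hs => by
          constructor
          · simp only [hf, Matrix.det_apply, Matrix.of_apply]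
            refine DifferentiableAt.fun_sum fun σ _ => DifferentiableAt.const_smul ?_ _
            refine DifferentiableAt.fun_finsetProd fun q _ => ?_
            have h1 := (hFan (i (σ q)) (i q) (u s (σ q), u s q)
              ⟨hus s hs _, hus s hs _⟩).differentiableAt
            exact h1.comp (f := fun s => (u s (σ q), u s q)) s ((hud _ s).prodMk (hud _ s))
          · exact norm_det_le_of_norm_le _ fun r q => hFB _ _ _ ⟨hus s hs r, hus s hs q⟩) hν
      have hfK : ∀ s ∈ Set.Icc (a (i p)) (b (i p)),
          kernelMinor K i (Function.update t p s) = f (s : ℂ) := by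
        intro s hs
        have hmem := update_mem_pi_Icc (a := fun p => a (i p)) (b := fun p => b (i p)) ht p hs
        have hcast : ∀ q, u (s : ℂ) q = ((Function.update t p s q : ℝ) : ℂ) := by
          intro q
          by_cases hq : q = p
          · subst hq; simp [hu]
          · simp [hu, hq]
        simp only [kernelMinor, hf, hcast]
        congr 1
        ext r q
        exact (hFK (i r) (i q) _ (hmem r trivial) _ (hmem q trivial)).symm
      refine ((hQ (i p)).norm_sum_sub_integral_le (hab _).le (hw _) hP
        (continuousOn_kernelMinor_update hK i p ht) (fun s hs => by
          rw [hfK s hs]; exact hPe s hs)).trans ?_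
      calc 2 * (b (i p) - a (i p)) * (2 * (√((n : ℝ) ^ n) * B ^ n) * ρ⁻¹ ^ ν / (1 - ρ⁻¹))
          ≤ 2 * L * (2 * (√((n : ℝ) ^ n) * B ^ n) * ρ⁻¹ ^ ν / (1 - ρ⁻¹)) := by
            gcongr
            exact hL _
        _ = _ := by ring) hz
  refine hmain.trans (le_of_eq ?_)
  rw [inv_pow]
  ring

end

theorem mainTheorem3 (N : ℕ) (a b : Fin N → ℝ) (hab : ∀ i, a i < b i)
    (K : Fin N → Fin N → ℝ → ℝ → ℂ)
    (hK : ∀ i j, ContinuousOn (Function.uncurry (K i j))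
      (Set.Icc (a i) (b i) ×ˢ Set.Icc (a j) (b j))) :
    -- the Fredholm determinant is a well defined entire function
    ((∀ (n : ℕ) (i : Fin n → Fin N),
        MeasureTheory.IntegrableOn (kernelMinor K i) (intervalBox a b i)) ∧
      (∀ z : ℂ, Summable (fredholmTerm a b K z)) ∧
      Differentiable ℂ (fredholmDet a b K)) ∧
    -- kernels of class `C^{k-1,1}`
    (∀ k : ℕ, 1 ≤ k →
      (∀ i j, IsCLip (k - 1) (Function.uncurry (K i j))
        (Set.Icc (a i) (b i) ×ˢ Set.Icc (a j) (b j))) →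
      ∀ R : ℝ, ∃ C : ℝ, ∀ ν : ℕ, k ≤ ν →
        ∀ Q : (∀ i, QuadratureRule (a i) (b i)),
          (∀ i, (Q i).HasOrder ν) → (∀ i, (Q i).HasPosWeights) →
          ∀ z : ℂ, ‖z‖ ≤ R →
            ‖nystromDet K Q z - fredholmDet a b K z‖ ≤ C * ((ν : ℝ) ^ k)⁻¹) ∧
    -- kernels that are bounded analytic on products of Bernstein ellipses
    (∀ ρ : ℝ, 1 < ρ →
      (∀ i j, IsBoundedAnalyticKernel (a i) (b i) (a j) (b j) ρ (K i j)) →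
      ∀ R : ℝ, ∃ C : ℝ, ∀ ν : ℕ, 1 ≤ ν →
        ∀ Q : (∀ i, QuadratureRule (a i) (b i)),
          (∀ i, (Q i).HasOrder ν) → (∀ i, (Q i).HasPosWeights) →
          ∀ z : ℂ, ‖z‖ ≤ R →
            ‖nystromDet K Q z - fredholmDet a b K z‖ ≤ C * (ρ ^ ν)⁻¹) := by
  refine ⟨⟨fun n i => (continuousOn_kernelMinor hK i).integrableOn_compact (isCompact_pi_Icc _ _),
    fredholmTerm_summable_and_differentiable hab hK⟩, fun k hk hKk R => ?_, fun ρ hρ hKρ R => ?_⟩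
  · obtain ⟨C, hC⟩ := exists_nystromDet_error_of_isCLip hab hK hKk R
    rw [Nat.sub_add_cancel hk] at hC
    exact ⟨C, fun ν hν Q => hC ν Q (hk.trans hν)⟩
  · obtain ⟨C, hC⟩ := exists_nystromDet_error_of_isBoundedAnalyticKernel hab hK hρ hKρ R
    exact ⟨C, fun ν hν Q => hC ν Q hν⟩
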